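/- Let $(X,d)$ be a complete metric space and let $\mathcal F=\{\varphi_1,\dots,\varphi_k\}$, $k\ge 1$, be an iterated function system generated by similarities, i.e. for each $i$ the map $\varphi_i:X\to X$ satisfies $d(\varphi_i(x),\varphi_i(y))=L_i\,d(x,y)$ for all $x,y\in X$, for some constant $0\le L_i<1$. Write $\operatorname{Lip}\varphi=\sup_{x\ne y} d(\varphi(x),\varphi(y))/d(x,y)$ (equal to $0$ if $X$ has at most one point). Let $s\ge 0$ be the similarity dimension of $\mathcal F$, i.e. the unique number with $$\sum_{i:\,\operatorname{Lip}\varphi_i>0}(\operatorname{Lip}\varphi_i)^s=1,$$ with the convention $s=0$ if $\operatorname{Lip}\varphi_i=0$ for all $i$. Let $K$ be the attractor of $\mathcal F$, i.e. the unique nonempty compact set $K\subset X$ with $K=\bigcup_{i=1}^k\varphi_i(K)$. If $K$ is connected and its $s$-dimensional Hausdorff measure $\mathcal H^s(K)$ is positive, then $K$ is a $(1/s)$-Hölder curve, i.e. there are a continuous map $f:[0,1]\to X$ with $f([0,1])=K$ and a constant $H<\infty$ such that $$d(f(x),f(y))\le H\,|x-y|^{1/s}\qquad\text{for all }x,y\in[0,1].$$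 In the degenerate case $s=0$ (where $1/s=\infty$) this is understood as: for every $\alpha>0$ there are such $f$ and $H$ with $\alpha$ in place of $1/s$. -/

import Mathlib

open MeasureTheory
open scoped ENNReal

/-- The Lipschitz constant `Lip φ = sup_{x ≠ y} dist (φ x) (φ y) / dist x y ∈ [0, ∞]`. -/
noncomputable def lip {X : Type*} [MetricSpace X] (φ : X → X) : ℝ≥0∞ :=
  ⨆ (x : X) (y : X) (_ : x ≠ y), edist (φ x) (φ y) / edist x y

/-- A contraction is a self-map whose Lipschitz constant is less than `1`. -/
def IsContraction {X : Type*} [MetricSpace X] (φ : X → X) : Prop :=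
  lip φ < 1

/-- A similarity, with ratio `0 ≤ L < 1`. -/
def IsSimilarity {X : Type*} [MetricSpace X] (φ : X → X) : Prop :=
  ∃ L : ℝ, 0 ≤ L ∧ L < 1 ∧ ∀ x y : X, dist (φ x) (φ y) = L * dist x y

/-- An iterated function system: a nonempty finite family of contractions. -/
structure IsIFS {X : Type*} [MetricSpace X] {ι : Type*} [Fintype ι] (F : ι → X → X) : Prop where
  nonempty : Nonempty ι
  contraction : ∀ i, IsContraction (F i)

/-- An iterated function system is trivial if all its maps have Lipschitz constant `0`. -/
def IsTrivialIFS {X : Type*} [MetricSpace X] {ι : Type*} (F : ι → X → X) : Prop :=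
  ∀ i, lip (F i) = 0

open Classical in
/-- `s` is the similarity dimension of `F`: the solution of `∑ (Lip φ)^s = 1`, or `0` if `F` is
trivial. Maps with Lipschitz constant `0` contribute `0` to the sum also for `s = 0`
(that is, `0^0` counts as `0` here), so that the solution exists and is unique for every
nontrivial system. -/
def IsSimilarityDimension {X : Type*} [MetricSpace X] {ι : Type*} [Fintype ι]
    (F : ι → X → X) (s : ℝ) : Prop :=
  (IsTrivialIFS F ∧ s = 0) ∨
    (¬ IsTrivialIFS F ∧ ∑ i, (if lip (F i) = 0 then 0 else (lip (F i)).toReal ^ s) = 1)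

/-- `K` is the attractor of `F`: the (unique) nonempty compact set `K` with `K = ⋃ φ(K)`. -/
structure IsAttractor {X : Type*} [MetricSpace X] {ι : Type*}
    (F : ι → X → X) (K : Set X) : Prop where
  nonempty : K.Nonempty
  isCompact : IsCompact K
  eq_iUnion : K = ⋃ i, F i '' K

/-- `K` is an `α`-Hölder curve: the image of a continuous map `f : [0,1] → X` with
`dist (f x) (f y) ≤ H |x - y|^α` for some finite constant `H`. -/
def IsHolderCurve {X : Type*} [MetricSpace X] (α : ℝ) (K : Set X) : Prop :=
  ∃ f : unitInterval → X, Continuous f ∧ Set.range f = K ∧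
    ∃ H : ℝ, ∀ x y : unitInterval, dist (f x) (f y) ≤ H * |(x : ℝ) - (y : ℝ)| ^ α

/-!
The curve is the limit of approximate parametrizations. Fix a length `n` and give every word `v` of
this length the mass `r_v ^ s`, where `r_v` is the ratio of the map of `v`; the masses add up to
`1`. If the words are visited along a path in which each word takes the time given by its mass,
and if `dist (x_v) (x_w) ≤ H |t_v - t_w| ^ (1 / s)` holds for the times of arrival up to an error
that tends to zero as `n` grows, then an ultrafilter limit of these paths is the required map
(`isHolderCurve_of_approx`, `IsSelfSimilar.isHolderCurve_of_words`). So a path that covers a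
distance `D` has to spend on the way at least a constant times the time `D ^ s`, and for this it is
enough that it runs through all of a cylinder whose ratio is comparable to `D`.

Positivity of `μH[s] K` enters through the Hausdorff content: the words whose pieces lie in a set
of diameter `D` have a mass of at most a constant times `D ^ s` (`IsSelfSimilar.exists_mass_le`).
Hence disjoint cylinders of ratio comparable to `D` that lie in a ball of radius comparable to `D`
are bounded in number.

If no piece of any level meets three others of the same level, then the pieces of a level form an
arc or a circle. The words are visited in the order along it, and connectedness of the piece around
a point in the middle of the way shows that this whole piece is run through
(`IsSelfSimilar.isHolderCurve_of_not_hasBranching`).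

Otherwise, some power of the system has a branching on its first level. Then there is a tree on the
words of length `n` such that edges join words with intersecting pieces, every cylinder spans a
subtree, and every cylinder contains two smaller ones of which neither lies below the other
(`IsSelfSimilar.exists_isWordTree`). The path is the depth-first exploration of this tree. By
`RTree.dist_le_of_isEvent`, it is to be shown that a path of diameter `D` from a vertex to a
descendant has branches of scale comparable to `D` on its left and on its right. The order in which
siblings are explored is chosen for this purpose (`RTree.exists_alternating_order`): the largest
child of a vertex alternately comes last and first, where the alternation is among the ancestors
whose second largest child has a scale in the same dyadic interval. Now the path crosses many
cylinders of ratio about `D / J`, and it has a branch of at least this scale in each of them. At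
most `N` vertices of the path have a much larger branch, by the bound on disjoint cylinders. The
scales of the other branches lie in about `log J` dyadic intervals, and since `J` exceeds
`(N + 1) log J`, two of them fall into the same interval without a much larger branch in between.
In between, the path therefore always descends to the largest child, so that the alternation
provides branches on both sides (`IsSelfSimilar.exists_branches`).
-/

open Filter Topology

/-! ### Hölder curves as limits of approximate parametrizations -/

/-- A compact set is a Hölder curve if for every `ε` it has a Hölder parametrization up to an error
of `ε`. Here the parametrization is a relation `R` between times and points. The map is the
pointwise limit of selections of these relations along an ultrafilter. -/
theorem isHolderCurve_of_approx {X : Type*} [MetricSpace X] {K : Set X} (hK : IsCompact K)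
    {α H : ℝ} (hα : 0 < α)
    (h : ∀ ε : ℝ, 0 < ε → ∃ R : Set (ℝ × X),
      (∀ p ∈ R, p.1 ∈ Set.Icc (0 : ℝ) 1 ∧ p.2 ∈ K) ∧
      (∀ t ∈ Set.Icc (0 : ℝ) 1, ∃ p ∈ R, |t - p.1| ≤ ε) ∧
      (∀ x ∈ K, ∃ p ∈ R, dist p.2 x ≤ ε) ∧
      (∀ p ∈ R, ∀ q ∈ R, dist p.2 q.2 ≤ H * |p.1 - q.1| ^ α + ε)) :
    IsHolderCurve α K := by
  classical
  set e : ℕ → ℝ := fun n => 1 / ((n : ℝ) + 1) with he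
  have epos : ∀ n, 0 < e n := fun n => by positivity
  have e0 : Tendsto e atTop (𝓝 0) := tendsto_one_div_add_atTop_nhds_zero_nat
  choose R hR1 hR2 hR3 hR4 using fun n => h (e n) (epos n)
  let U : Ultrafilter ℕ := hyperfilter ℕ
  have hU : (U : Filter ℕ) ≤ atTop := by
    rw [← Nat.cofinite_eq_atTop]; exact hyperfilter_le_cofinite
  have e0U : Tendsto e U (𝓝 0) := e0.mono_left hU
  choose g hgR hgt using fun (n : ℕ) (t : unitInterval) => hR2 n t t.2
  have hlim : ∀ t : unitInterval, ∃ x ∈ K, Tendsto (fun n => (g n t).2) U (𝓝 x) := by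
    intro t
    obtain ⟨x, hx, hle⟩ := hK.ultrafilter_le_nhds (U.map fun n => (g n t).2)
      (by
        rw [le_principal_iff]
        exact Filter.Eventually.of_forall (f := (U : Filter ℕ)) fun n => (hR1 n _ (hgR n t)).2)
    exact ⟨x, hx, hle⟩
  choose f hfK hf using hlim
  have hcomp : ∀ (t : unitInterval) (τ : ℕ → ℝ) (y : ℕ → X) (τ' : ℝ) (y' : X),
      (∀ n, (τ n, y n) ∈ R n) → Tendsto τ U (𝓝 τ') → Tendsto y U (𝓝 y') →
      dist (f t) y' ≤ H * |(t : ℝ) - τ'| ^ α := by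
    intro t τ y τ' y' hmem hτ hy
    have h1 : Tendsto (fun n => dist (g n t).2 (y n)) U (𝓝 (dist (f t) y')) := (hf t).dist hy
    have h0 : Tendsto (fun n => (g n t).1) U (𝓝 (t : ℝ)) := by
      rw [tendsto_iff_dist_tendsto_zero]
      refine squeeze_zero (fun _ => dist_nonneg) (fun n => ?_) e0U
      rw [Real.dist_eq, abs_sub_comm]; exact hgt n t
    have h2 : Tendsto (fun n => H * |(g n t).1 - τ n| ^ α + e n) U
        (𝓝 (H * |(t : ℝ) - τ'| ^ α + 0)) :=
      ((((h0.sub hτ).abs).rpow_const (Or.inr hα.le)).const_mul H).add e0U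
    rw [add_zero] at h2
    exact le_of_tendsto_of_tendsto' h1 h2 fun n => hR4 n _ (hgR n t) _ (hmem n)
  have hhol : ∀ t t' : unitInterval, dist (f t) (f t') ≤ H * |(t : ℝ) - (t' : ℝ)| ^ α := by
    intro t t'
    refine hcomp t (fun n => (g n t').1) (fun n => (g n t').2) t' (f t') (fun n => hgR n t') ?_
      (hf t')
    rw [tendsto_iff_dist_tendsto_zero]
    refine squeeze_zero (fun _ => dist_nonneg) (fun n => ?_) e0U
    rw [Real.dist_eq, abs_sub_comm]; exact hgt n t'
  refine ⟨f, ?_, ?_, H, hhol⟩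
  · rw [continuous_iff_continuousAt]
    intro t
    rw [ContinuousAt, tendsto_iff_dist_tendsto_zero]
    have hc : Continuous fun t' : unitInterval => H * |(t' : ℝ) - (t : ℝ)| ^ α := by
      refine continuous_const.mul (Continuous.rpow_const (by fun_prop) fun _ => Or.inr hα.le)
    have h2 := hc.tendsto t
    simp only [sub_self, abs_zero, Real.zero_rpow hα.ne', mul_zero] at h2
    exact squeeze_zero (fun _ => dist_nonneg) (fun t' => hhol t' t) h2
  · apply Set.Subset.antisymm
    · rintro _ ⟨t, rfl⟩; exact hfK t
    · intro x hx
      choose q hqR hqx using fun n => hR3 n x hx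
      obtain ⟨τ, hτ, hle⟩ := (isCompact_Icc (a := (0 : ℝ)) (b := 1)).ultrafilter_le_nhds
        (U.map fun n => (q n).1)
        (by
          rw [le_principal_iff]
          exact Filter.Eventually.of_forall (f := (U : Filter ℕ)) fun n => (hR1 n _ (hqR n)).1)
      refine ⟨⟨τ, hτ⟩, ?_⟩
      have h3 := hcomp ⟨τ, hτ⟩ (fun n => (q n).1) (fun n => (q n).2) τ x hqR hle (by
        rw [tendsto_iff_dist_tendsto_zero]
        exact squeeze_zero (fun _ => dist_nonneg) hqx e0U)
      simp only [sub_self, abs_zero, Real.zero_rpow hα.ne', mul_zero] at h3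
      exact dist_le_zero.1 h3

/-! ### Rooted trees and their depth-first exploration -/

/-- A rooted tree on the vertex set `V`, given by its parent map (which fixes the root) and the
depth of each vertex. -/
structure RTree (V : Type*) where
  /-- The parent of a vertex. -/
  par : V → V
  /-- The root. -/
  root : V
  /-- The depth of a vertex: its distance to the root. -/
  dep : V → ℕ
  par_root : par root = root
  dep_root : dep root = 0
  dep_par : ∀ v, v ≠ root → dep v = dep (par v) + 1

namespace RTree

variable {V : Type*} (T : RTree V)

/-- `a` is an ancestor of `b`, or `b` itself. -/
def Anc (a b : V) : Prop := ∃ k, T.par^[k] b = a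

/-- `c` is a child of `p`. -/
def IsChild (c p : V) : Prop := c ≠ T.root ∧ T.par c = p

variable {T}

theorem Anc.refl (a : V) : T.Anc a a := ⟨0, rfl⟩

theorem Anc.trans {a b c : V} (h₁ : T.Anc a b) (h₂ : T.Anc b c) : T.Anc a c := by
  obtain ⟨k, rfl⟩ := h₁
  obtain ⟨l, rfl⟩ := h₂
  exact ⟨k + l, by rw [Function.iterate_add_apply]⟩

theorem anc_par (v : V) : T.Anc (T.par v) v := ⟨1, rfl⟩

theorem IsChild.anc {c p : V} (h : T.IsChild c p) : T.Anc p c := h.2 ▸ anc_par c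

theorem IsChild.dep {c p : V} (h : T.IsChild c p) : T.dep c = T.dep p + 1 := by
  rw [T.dep_par c h.1, h.2]

theorem iterate_root (k : ℕ) : T.par^[k] T.root = T.root := Function.iterate_fixed T.par_root k

theorem dep_iterate (k : ℕ) (v : V) : T.dep (T.par^[k] v) = T.dep v - k := by
  induction k with
  | zero => simp
  | succ k ih =>
    rw [Function.iterate_succ_apply']
    by_cases h : T.par^[k] v = T.root
    · rw [h, T.par_root, T.dep_root]
      rw [h, T.dep_root] at ih; omega
    · have := T.dep_par _ h; omega

theorem eq_root_of_dep_eq_zero {v : V} (h : T.dep v = 0) : v = T.root := by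
  by_contra h'
  have := T.dep_par v h'
  omega

theorem root_anc (v : V) : T.Anc T.root v :=
  ⟨T.dep v, eq_root_of_dep_eq_zero (by rw [dep_iterate]; omega)⟩

theorem Anc.dep_le {a b : V} (h : T.Anc a b) : T.dep a ≤ T.dep b := by
  obtain ⟨k, rfl⟩ := h
  rw [dep_iterate]; omega

/-- The ancestors of `b` are the iterates of the parent map, indexed by the depth difference. -/
theorem Anc.iterate_eq {a b : V} (h : T.Anc a b) : T.par^[T.dep b - T.dep a] b = a := by
  obtain ⟨k, rfl⟩ := h
  rw [dep_iterate]
  by_cases hk : k ≤ T.dep b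
  · congr 2; omega
  · have h1 : T.par^[k] b = T.root := eq_root_of_dep_eq_zero (by rw [dep_iterate]; omega)
    rw [h1]
    exact eq_root_of_dep_eq_zero (by rw [dep_iterate]; omega)

theorem Anc.eq_of_dep_eq {a b : V} (h : T.Anc a b) (hd : T.dep a = T.dep b) : a = b := by
  have := h.iterate_eq
  rw [hd, Nat.sub_self] at this
  exact this.symm

theorem Anc.anc_of_dep_le {a b c : V} (ha : T.Anc a c) (hb : T.Anc b c)
    (h : T.dep a ≤ T.dep b) : T.Anc a b := by
  have h2 := hb.dep_le
  refine ⟨T.dep b - T.dep a, ?_⟩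
  calc T.par^[T.dep b - T.dep a] b
      = T.par^[T.dep b - T.dep a] (T.par^[T.dep c - T.dep b] c) := by rw [hb.iterate_eq]
    _ = T.par^[T.dep c - T.dep a] c := by
        rw [← Function.iterate_add_apply]
        congr 1; omega
    _ = a := ha.iterate_eq

theorem Anc.total {a b c : V} (ha : T.Anc a c) (hb : T.Anc b c) : T.Anc a b ∨ T.Anc b a := by
  rcases le_total (T.dep a) (T.dep b) with h | h
  · exact Or.inl (ha.anc_of_dep_le hb h)
  · exact Or.inr (hb.anc_of_dep_le ha h)

theorem Anc.antisymm {a b : V} (h₁ : T.Anc a b) (h₂ : T.Anc b a) : a = b :=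
  h₁.eq_of_dep_eq (le_antisymm h₁.dep_le h₂.dep_le)

theorem Anc.eq_of_root {a : V} (h : T.Anc a T.root) : a = T.root := by
  obtain ⟨k, rfl⟩ := h
  exact iterate_root k

theorem Anc.anc_par {a v : V} (h : T.Anc a v) (hne : a ≠ v) : v ≠ T.root ∧ T.Anc a (T.par v) := by
  refine ⟨?_, ?_⟩
  · rintro rfl; exact hne h.eq_of_root
  · obtain ⟨k, rfl⟩ := h
    cases k with
    | zero => exact absurd rfl hne
    | succ k => exact ⟨k, rfl⟩

theorem Anc.exists_child {a v : V} (h : T.Anc a v) (hne : a ≠ v) :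
    ∃ c, T.IsChild c a ∧ T.Anc c v := by
  obtain ⟨k, rfl⟩ := h
  induction k with
  | zero => exact absurd rfl hne
  | succ k ih =>
    by_cases h : T.par^[k] v = T.root
    · have h1 : T.par^[k+1] v = T.par^[k] v := by
        rw [Function.iterate_succ_apply', h, T.par_root]
      rw [h1] at hne ⊢
      exact ih hne
    · exact ⟨T.par^[k] v, ⟨h, (Function.iterate_succ_apply' _ _ _).symm⟩, k, rfl⟩

theorem IsChild.not_anc {c p : V} (h : T.IsChild c p) : ¬ T.Anc c p := fun h' => by
  have := h'.dep_le; have := h.dep; omega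

/-- The subtrees of distinct children of a vertex are disjoint. -/
theorem IsChild.eq_of_anc {c c' p v : V} (h : T.IsChild c p) (h' : T.IsChild c' p)
    (hc : T.Anc c v) (hc' : T.Anc c' v) : c = c' :=
  (hc.anc_of_dep_le hc' (by rw [h.dep, h'.dep])).eq_of_dep_eq (by rw [h.dep, h'.dep])

section Mass

open Finset

open Classical in
/-- The set of descendants of `v`, including `v`. -/
noncomputable def desc [Fintype V] (T : RTree V) (v : V) : Finset V := univ.filter (T.Anc v)

open Classical in
/-- The set of children of `p`. -/
noncomputable def children [Fintype V] (T : RTree V) (p : V) : Finset V :=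
  univ.filter fun c => T.IsChild c p

variable [Fintype V]

@[simp] theorem mem_desc {v w : V} : w ∈ T.desc v ↔ T.Anc v w := by simp [desc]

@[simp] theorem mem_children {c p : V} : c ∈ T.children p ↔ T.IsChild c p := by simp [children]

variable (T) (m : V → ℝ) (rk : V → ℕ)

/-- The mass of the subtree of descendants of `v`. -/
noncomputable def mass (v : V) : ℝ := ∑ w ∈ T.desc v, m w

/-- The total mass explored between the arrival at the parent of `v` and the arrival at `v`, when
siblings are explored in the order of increasing `rk`. -/
noncomputable def gain (v : V) : ℝ :=
  m (T.par v) + ∑ c ∈ (T.children (T.par v)).filter (fun c => rk c < rk v), T.mass m c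

/-- The time of arrival at `v` in the depth-first exploration of the tree in which siblings are
explored in the order of increasing `rk`, and each vertex `w` takes the time `m w`. The subtree of
`v` is explored during `[start v, start v + mass v]`. -/
noncomputable def start (v : V) : ℝ := ∑ k ∈ range (T.dep v), T.gain m rk (T.par^[k] v)

variable {T m rk}

theorem mass_eq_add (p : V) : T.mass m p = m p + ∑ c ∈ T.children p, T.mass m c := by
  classical
  have h : T.desc p = insert p ((T.children p).biUnion T.desc) := by
    ext w
    simp only [mem_desc, mem_insert, mem_biUnion, mem_children]
    constructor
    · intro h
      by_cases hw : w = p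
      · exact Or.inl hw
      · exact Or.inr (h.exists_child (Ne.symm hw))
    · rintro (rfl | ⟨c, hc, hcw⟩)
      · exact Anc.refl _
      · exact hc.anc.trans hcw
  rw [mass, h, sum_insert, sum_biUnion]
  · rfl
  · intro c hc c' hc' hne
    refine Finset.disjoint_left.2 fun w hw hw' => hne ?_
    exact (mem_children.1 hc).eq_of_anc (mem_children.1 hc') (mem_desc.1 hw) (mem_desc.1 hw')
  · simp only [mem_biUnion, mem_children, mem_desc, not_exists, not_and]
    exact fun c hc => hc.not_anc

theorem mass_nonneg (hm : ∀ v, 0 ≤ m v) (v : V) : 0 ≤ T.mass m v := sum_nonneg fun w _ => hm w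

theorem start_root : T.start m rk T.root = 0 := by simp [start, T.dep_root]

theorem start_eq {c p : V} (h : T.IsChild c p) :
    T.start m rk c = T.start m rk p + m p +
      ∑ c' ∈ (T.children p).filter (fun c' => rk c' < rk c), T.mass m c' := by
  have hg : T.gain m rk c = m p +
      ∑ c' ∈ (T.children p).filter (fun c' => rk c' < rk c), T.mass m c' := by
    rw [gain, h.2]
  rw [start, h.dep, sum_range_succ']
  simp only [Function.iterate_succ_apply, h.2, Function.iterate_zero, id, hg]
  rw [start]; ring

theorem start_add_le {c p : V} (hm : ∀ v, 0 ≤ m v) (h : T.IsChild c p) :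
    T.start m rk p + m p ≤ T.start m rk c := by
  rw [start_eq h]
  have := sum_nonneg (s := (T.children p).filter (fun c' => rk c' < rk c))
    (f := fun c' => T.mass m c') (fun c' _ => mass_nonneg hm c')
  linarith

theorem start_add_mass_le_of_child {c p : V} (hm : ∀ v, 0 ≤ m v) (h : T.IsChild c p) :
    T.start m rk c + T.mass m c ≤ T.start m rk p + T.mass m p := by
  classical
  rw [start_eq h, mass_eq_add p]
  have h1 : ∑ c' ∈ (T.children p).filter (fun c' => rk c' < rk c), T.mass m c' + T.mass m c
      ≤ ∑ c' ∈ T.children p, T.mass m c' := by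
    rw [add_comm, ← sum_insert (by simp)]
    refine sum_le_sum_of_subset_of_nonneg ?_ fun c' _ _ => mass_nonneg hm c'
    intro c'
    simp only [mem_insert, mem_filter, mem_children]
    rintro (rfl | h')
    · exact h
    · exact h'.1
  linarith

theorem start_add_mass_le_of_lt {c c' p : V} (hm : ∀ v, 0 ≤ m v) (h : T.IsChild c p)
    (h' : T.IsChild c' p) (hlt : rk c < rk c') :
    T.start m rk c + T.mass m c ≤ T.start m rk c' := by
  classical
  rw [start_eq h, start_eq h']
  have h1 : ∑ a ∈ (T.children p).filter (fun a => rk a < rk c), T.mass m a + T.mass m c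
      ≤ ∑ a ∈ (T.children p).filter (fun a => rk a < rk c'), T.mass m a := by
    rw [add_comm, ← sum_insert (by simp)]
    refine sum_le_sum_of_subset_of_nonneg ?_ fun c' _ _ => mass_nonneg hm c'
    intro a
    simp only [mem_insert, mem_filter, mem_children]
    rintro (rfl | ⟨h1, h2⟩)
    · exact ⟨h, hlt⟩
    · exact ⟨h1, h2.trans hlt⟩
  linarith

theorem Anc.start_le {a b : V} (hm : ∀ v, 0 ≤ m v) (h : T.Anc a b) :
    T.start m rk a ≤ T.start m rk b ∧
      T.start m rk b + T.mass m b ≤ T.start m rk a + T.mass m a := by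
  obtain ⟨k, rfl⟩ := h
  induction k with
  | zero => simp
  | succ k ih =>
    rw [Function.iterate_succ_apply']
    by_cases h : T.par^[k] b = T.root
    · rw [h, T.par_root, ← h]; exact ih
    · have hc : T.IsChild (T.par^[k] b) (T.par (T.par^[k] b)) := ⟨h, rfl⟩
      have h1 := start_add_le (rk := rk) hm hc
      have h2 := start_add_mass_le_of_child (rk := rk) hm hc
      have := hm (T.par (T.par^[k] b))
      constructor <;> linarith

theorem mass_root : T.mass m T.root = ∑ v, m v := by
  rw [mass]
  congr 1
  ext v
  simp [root_anc]

/-- Every time lies in the interval during which the exploration stays at some vertex. -/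
theorem exists_start_le (hrk : ∀ c c' p, T.IsChild c p → T.IsChild c' p →
    rk c = rk c' → c = c') {τ : ℝ} (h0 : 0 ≤ τ) (h1 : τ ≤ ∑ v, m v) :
    ∃ v, T.start m rk v ≤ τ ∧ τ ≤ T.start m rk v + m v := by
  classical
  obtain ⟨v, hv, hmax⟩ := exists_max_image
    (univ.filter fun v => T.start m rk v ≤ τ ∧ τ ≤ T.start m rk v + T.mass m v) T.dep
    ⟨T.root, by simp [start_root, mass_root, h0, h1]⟩
  simp only [mem_filter, mem_univ, true_and] at hv hmax
  refine ⟨v, hv.1, ?_⟩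
  by_contra! hlt
  -- the first child whose exploration ends after `τ` contradicts the choice of `v`
  let E : V → ℝ := fun c => T.start m rk v + m v +
    ∑ c' ∈ (T.children v).filter (fun c' => rk c' ≤ rk c), T.mass m c'
  have hne : (T.children v).Nonempty := by
    by_contra hemp
    rw [not_nonempty_iff_eq_empty] at hemp
    have := mass_eq_add (T := T) (m := m) v
    rw [hemp, sum_empty] at this
    linarith [hv.2]
  have hlast : ((T.children v).filter fun c => τ ≤ E c).Nonempty := by
    obtain ⟨c, hc, hcmax⟩ := exists_max_image (T.children v) rk hne
    refine ⟨c, mem_filter.2 ⟨hc, ?_⟩⟩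
    have : (T.children v).filter (fun c' => rk c' ≤ rk c) = T.children v :=
      filter_true_of_mem hcmax
    simp only [E, this]
    have := mass_eq_add (T := T) (m := m) v
    linarith [hv.2]
  obtain ⟨c, hc, hcmin⟩ := exists_min_image _ rk hlast
  simp only [mem_filter, mem_children] at hc hcmin
  have hE : E c = T.start m rk c + T.mass m c := by
    have : (T.children v).filter (fun c' => rk c' ≤ rk c) =
        insert c ((T.children v).filter (fun c' => rk c' < rk c)) := by
      ext a
      simp only [mem_filter, mem_children, mem_insert]
      constructor
      · rintro ⟨ha, hle⟩
        rcases hle.lt_or_eq with h | h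
        · exact Or.inr ⟨ha, h⟩
        · exact Or.inl (hrk _ _ _ ha hc.1 h)
      · rintro (rfl | ⟨ha, h⟩)
        · exact ⟨hc.1, le_rfl⟩
        · exact ⟨ha, h.le⟩
    simp only [E, this]
    rw [sum_insert (by simp), start_eq hc.1]; ring
  have hstart : T.start m rk c ≤ τ := by
    rw [start_eq hc.1]
    rcases ((T.children v).filter fun c' => rk c' < rk c).eq_empty_or_nonempty with he | he
    · rw [he, sum_empty]; linarith
    · obtain ⟨b, hb, hbmax⟩ := exists_max_image _ rk he
      simp only [mem_filter, mem_children] at hb hbmax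
      have hnot : ¬ τ ≤ E b := fun hle => absurd (hcmin b ⟨hb.1, hle⟩) (by omega)
      have : (T.children v).filter (fun c' => rk c' < rk c) =
          (T.children v).filter (fun c' => rk c' ≤ rk b) := by
        ext a
        simp only [mem_filter, mem_children]
        constructor
        · rintro ⟨ha, h⟩; exact ⟨ha, hbmax a ⟨ha, h⟩⟩
        · rintro ⟨ha, h⟩; exact ⟨ha, h.trans_lt hb.2⟩
      rw [this]
      exact (not_le.1 hnot).le
  have := hmax c ⟨hstart, by rw [← hE]; exact hc.2⟩
  have := hc.1.dep
  omega

/-- Two vertices neither of which is an ancestor of the other lie below distinct siblings. -/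
theorem exists_siblings {v w : V} (h₁ : ¬ T.Anc v w) (h₂ : ¬ T.Anc w v) :
    ∃ z c c', T.IsChild c z ∧ T.IsChild c' z ∧ c ≠ c' ∧ T.Anc c v ∧ T.Anc c' w := by
  classical
  obtain ⟨z, hz, hmax⟩ := exists_max_image (univ.filter fun z => T.Anc z v ∧ T.Anc z w) T.dep
    ⟨T.root, by simp [root_anc]⟩
  simp only [mem_filter, mem_univ, true_and] at hz hmax
  obtain ⟨c, hc, hcv⟩ := hz.1.exists_child (by rintro rfl; exact h₁ hz.2)
  obtain ⟨c', hc', hcw⟩ := hz.2.exists_child (by rintro rfl; exact h₂ hz.1)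
  refine ⟨z, c, c', hc, hc', ?_, hcv, hcw⟩
  rintro rfl
  have := hmax c ⟨hcv, hcw⟩
  have := hc.dep
  omega

/-- The pairs of a time and a vertex at which the depth-first exploration enters the subtree of
the vertex, or leaves it. -/
def IsEvent (T : RTree V) (m : V → ℝ) (rk : V → ℕ) (τ : ℝ) (v : V) : Prop :=
  τ = T.start m rk v ∨ τ = T.start m rk v + T.mass m v

theorem IsEvent.mem {τ : ℝ} {v : V} (h : T.IsEvent m rk τ v) (hm : ∀ v, 0 ≤ m v) :
    T.start m rk v ≤ τ ∧ τ ≤ T.start m rk v + T.mass m v := by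
  have := mass_nonneg (T := T) hm v
  rcases h with rfl | rfl
  · exact ⟨le_rfl, by linarith⟩
  · exact ⟨by linarith, le_rfl⟩

/-- If the distance between a vertex and a descendant is controlled by the mass explored on either
side of the path that joins them, then the distance between any two positions of the exploration
is controlled by the time in between. -/
theorem dist_le_of_isEvent {X : Type*} [MetricSpace X] {x : V → X} {a H η : ℝ} (ha : 0 < a)
    (hH : 0 ≤ H) (hη : 0 ≤ η) (hm : ∀ v, 0 ≤ m v)
    (hrk : ∀ c c' p, T.IsChild c p → T.IsChild c' p → rk c = rk c' → c = c')
    (hadj : ∀ v, dist (x v) (x (T.par v)) ≤ η)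
    (hL : ∀ z y, T.Anc z y →
      dist (x z) (x y) ≤ H * (T.start m rk y - T.start m rk z) ^ a + η)
    (hR : ∀ z y, T.Anc z y → dist (x z) (x y) ≤
      H * (T.start m rk z + T.mass m z - (T.start m rk y + T.mass m y)) ^ a + η)
    {τ τ' : ℝ} {v w : V} (hv : T.IsEvent m rk τ v) (hw : T.IsEvent m rk τ' w) :
    dist (x v) (x w) ≤ 2 * H * |τ - τ'| ^ a + 4 * η := by
  have hpow : ∀ τ τ' : ℝ, 0 ≤ |τ - τ'| ^ a := fun _ _ => Real.rpow_nonneg (abs_nonneg _) _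
  have key1 : ∀ (τ τ' : ℝ) (v w : V), T.IsEvent m rk τ v → T.IsEvent m rk τ' w → T.Anc v w →
      dist (x v) (x w) ≤ 2 * H * |τ - τ'| ^ a + 4 * η := by
    intro τ τ' v w hv hw hvw
    have hw' := hw.mem hm
    have hvw' := hvw.start_le (rk := rk) hm
    have hmono : ∀ u : ℝ, 0 ≤ u → u ≤ |τ - τ'| → H * u ^ a + η ≤ 2 * H * |τ - τ'| ^ a + 4 * η := by
      intro u hu0 hu
      have := mul_le_mul_of_nonneg_left (Real.rpow_le_rpow hu0 hu ha.le) hH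
      have := mul_nonneg hH (hpow τ τ')
      linarith
    rcases hv with rfl | rfl
    · refine (hL v w hvw).trans (hmono _ (by linarith) ?_)
      rw [abs_sub_comm, abs_of_nonneg (by linarith)]; linarith
    · refine (hR v w hvw).trans (hmono _ (by linarith) ?_)
      rw [abs_of_nonneg (by linarith)]; linarith
  have key2 : ∀ (τ τ' : ℝ) (v w z c c' : V), T.IsEvent m rk τ v → T.IsEvent m rk τ' w →
      T.IsChild c z → T.IsChild c' z → rk c < rk c' → T.Anc c v → T.Anc c' w →
      dist (x v) (x w) ≤ 2 * H * |τ - τ'| ^ a + 4 * η := by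
    intro τ τ' v w z c c' hv hw hc hc' hlt hcv hcw
    have hv' := hv.mem hm
    have hw' := hw.mem hm
    have h1 := hcv.start_le (rk := rk) hm
    have h2 := hcw.start_le (rk := rk) hm
    have h3 := start_add_mass_le_of_lt hm hc hc' hlt
    have e1 := hR c v hcv
    have e2 := hL c' w hcw
    have e3 := hadj c
    have e4 := hadj c'
    rw [hc.2] at e3
    rw [hc'.2] at e4
    have m1 := mul_le_mul_of_nonneg_left (Real.rpow_le_rpow (by linarith)
      (show T.start m rk c + T.mass m c - (T.start m rk v + T.mass m v) ≤ |τ - τ'| by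
        rw [abs_sub_comm, abs_of_nonneg (by linarith)]; linarith) ha.le) hH
    have m2 := mul_le_mul_of_nonneg_left (Real.rpow_le_rpow (by linarith)
      (show T.start m rk w - T.start m rk c' ≤ |τ - τ'| by
        rw [abs_sub_comm, abs_of_nonneg (by linarith)]; linarith) ha.le) hH
    have t1 := dist_triangle4 (x v) (x c) (x z) (x c')
    have t2 := dist_triangle (x v) (x c') (x w)
    rw [dist_comm (x v) (x c)] at t1
    rw [dist_comm (x c') (x z)] at e4
    linarith
  by_cases h1 : T.Anc v w
  · exact key1 τ τ' v w hv hw h1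
  by_cases h2 : T.Anc w v
  · rw [dist_comm, abs_sub_comm]; exact key1 τ' τ w v hw hv h2
  obtain ⟨z, c, c', hc, hc', hne, hcv, hcw⟩ := exists_siblings h1 h2
  rcases lt_trichotomy (rk c) (rk c') with h | h | h
  · exact key2 τ τ' v w z c c' hv hw hc hc' h hcv hcw
  · exact absurd (hrk _ _ _ hc hc' h) hne
  · rw [dist_comm, abs_sub_comm]
    exact key2 τ' τ w v z c' c hw hv hc' hc h hcw hcv

end Mass

end RTree

/-! ### Hausdorff content, words and cylinders -/

section Content

variable {X : Type*} [MetricSpace X]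

/-- The `s`-dimensional Hausdorff content, defined like the Hausdorff measure, but by coverings by
sets of arbitrary size. -/
noncomputable def hausdorffContent (X : Type*) [MetricSpace X] (s : ℝ) : OuterMeasure X :=
  OuterMeasure.mkMetric'.pre (fun S => Metric.ediam S ^ s) ⊤

theorem hausdorffContent_le (s : ℝ) (S : Set X) :
    hausdorffContent X s S ≤ Metric.ediam S ^ s :=
  OuterMeasure.mkMetric'.pre_le le_top

/-- A set of content zero is a null set for the Hausdorff measure: for `0 < s`, the sets of a covering
of small total content have small diameters. -/
theorem hausdorffContent_pos [MeasurableSpace X] [BorelSpace X] {s : ℝ} (hs : 0 < s) {K : Set X}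
    (h : 0 < μH[s] K) : 0 < hausdorffContent X s K := by
  rw [pos_iff_ne_zero] at h ⊢
  intro h0
  apply h
  have h1 : μH[s] K = OuterMeasure.mkMetric (fun r : ℝ≥0∞ => r ^ s) K := by
    rw [OuterMeasure.coe_mkMetric]; rfl
  rw [h1, OuterMeasure.mkMetric, OuterMeasure.mkMetric']
  simp only [OuterMeasure.iSup_apply, ENNReal.iSup_eq_zero]
  intro δ hδ
  refine le_antisymm (ENNReal.le_of_forall_pos_le_add fun ε hε _ => ?_) bot_le
  rw [zero_add]
  set η : ℝ≥0∞ := min ε (δ ^ s) with hη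
  have hηpos : 0 < η := lt_min (by exact_mod_cast hε) (ENNReal.rpow_pos_of_nonneg hδ hs.le)
  rw [hausdorffContent, OuterMeasure.mkMetric'.pre, OuterMeasure.boundedBy_apply] at h0
  rw [← h0] at hηpos
  obtain ⟨t, ht⟩ := iInf_lt_iff.1 hηpos
  obtain ⟨hKt, ht⟩ := iInf_lt_iff.1 ht
  have hdiam : ∀ n, Metric.ediam (t n) ≤ δ := by
    intro n
    rcases (t n).eq_empty_or_nonempty with hn | hn
    · simp [hn]
    · have h2 : Metric.ediam (t n) ^ s ≤ δ ^ s := by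
        calc Metric.ediam (t n) ^ s ≤ ⨆ _ : (t n).Nonempty,
              extend (fun S (_ : Metric.ediam S ≤ ⊤) => Metric.ediam S ^ s) (t n) := by
              simp [hn, extend]
          _ ≤ _ := ENNReal.le_tsum n
          _ ≤ η := ht.le
          _ ≤ δ ^ s := min_le_right _ _
      exact (ENNReal.rpow_le_rpow_iff hs).1 h2
  calc OuterMeasure.mkMetric'.pre (fun S => Metric.ediam S ^ s) δ K
      ≤ OuterMeasure.mkMetric'.pre (fun S => Metric.ediam S ^ s) δ (⋃ n, t n) :=
        measure_mono hKt
    _ ≤ ∑' n, OuterMeasure.mkMetric'.pre (fun S => Metric.ediam S ^ s) δ (t n) :=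
        measure_iUnion_le _
    _ ≤ ∑' n, ⨆ _ : (t n).Nonempty,
          extend (fun S (_ : Metric.ediam S ≤ ⊤) => Metric.ediam S ^ s) (t n) := by
        refine ENNReal.tsum_le_tsum fun n => ?_
        rcases (t n).eq_empty_or_nonempty with hn | hn
        · simp [hn]
        · simp only [hn, extend, le_top, iInf_pos, iSup_pos]
          exact OuterMeasure.mkMetric'.pre_le (hdiam n)
    _ ≤ η := ht.le
    _ ≤ ε := min_le_left _ _

theorem hausdorffContent_image_le {s : ℝ} (hs : 0 ≤ s) {f : X → X} {L : ℝ} (hL : 0 < L)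
    (hf : ∀ x y, dist (f x) (f y) = L * dist x y) (S : Set X) :
    hausdorffContent X s (f '' S) ≤ ENNReal.ofReal (L ^ s) * hausdorffContent X s S := by
  have hc : ENNReal.ofReal (L ^ s) ≠ 0 := by
    simpa using Real.rpow_pos_of_pos hL s
  have hlip : LipschitzWith (Real.toNNReal L) f := LipschitzWith.of_dist_le_mul fun x y => by
    rw [hf, Real.coe_toNNReal _ hL.le]
  have h : (ENNReal.ofReal (L ^ s))⁻¹ • OuterMeasure.comap f (hausdorffContent X s) ≤
      hausdorffContent X s := by
    refine OuterMeasure.mkMetric'.le_pre.2 fun S _ => ?_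
    rw [_root_.smul_apply, OuterMeasure.comap_apply, smul_eq_mul, mul_comm,
      ← div_eq_mul_inv]
    refine ENNReal.div_le_of_le_mul ?_
    refine (hausdorffContent_le s _).trans ?_
    calc Metric.ediam (f '' S) ^ s ≤ ((Real.toNNReal L : ℝ≥0∞) * Metric.ediam S) ^ s :=
          ENNReal.rpow_le_rpow (hlip.ediam_image_le S) hs
      _ = Metric.ediam S ^ s * ENNReal.ofReal (L ^ s) := by
          rw [ENNReal.mul_rpow_of_nonneg _ _ hs, mul_comm, ← ENNReal.ofReal_rpow_of_pos hL]
          rfl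
  have h1 := h S
  rw [_root_.smul_apply, OuterMeasure.comap_apply, smul_eq_mul, mul_comm,
    ← div_eq_mul_inv] at h1
  rw [mul_comm]
  rwa [ENNReal.div_le_iff hc ENNReal.ofReal_ne_top] at h1

end Content

section Words

variable {A : Type*}

/-- The contraction ratio of the map of a word: the product of the ratios of its letters. -/
def wordRatio (r : A → ℝ) (w : List A) : ℝ := (w.map r).prod

/-- The map of a word. Words are read from right to left: the last letter is applied last, so that
the cylinder of a word consists of the words of which it is a suffix. -/
def wordMap {X : Type*} (φ : A → X → X) : List A → X → X
  | [] => id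
  | i :: w => wordMap φ w ∘ φ i

/-- The piece of `K` with address `w`. -/
def piece {X : Type*} (φ : A → X → X) (K : Set X) (w : List A) : Set X := wordMap φ w '' K

@[simp] theorem wordRatio_nil (r : A → ℝ) : wordRatio r [] = 1 := by simp [wordRatio]

@[simp] theorem wordRatio_cons (r : A → ℝ) (i : A) (w : List A) :
    wordRatio r (i :: w) = r i * wordRatio r w := by simp [wordRatio]

theorem sum_vector_succ [Fintype A] {M : Type*} [AddCommMonoid M] {n : ℕ}
    (f : List.Vector A (n + 1) → M) :
    ∑ v, f v = ∑ w : List.Vector A n, ∑ i, f (i ::ᵥ w) := by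
  rw [← Fintype.sum_prod_type' (fun (w : List.Vector A n) (i : A) => f (i ::ᵥ w))]
  refine (Fintype.sum_bijective (fun p : List.Vector A n × A => p.2 ::ᵥ p.1) ?_ _ _
    fun _ => rfl).symm
  constructor
  · rintro ⟨w, i⟩ ⟨w', i'⟩ h
    have h1 := congrArg List.Vector.head h
    have h2 := congrArg List.Vector.tail h
    simp only [List.Vector.head_cons, List.Vector.tail_cons] at h1 h2
    rw [h1, h2]
  · intro v
    exact ⟨(v.tail, v.head), by simp⟩

/-- An iterated function system of similarities with positive ratios, together with its similarity
dimension `s` and its attractor `K`, which is connected and of positive `s`-dimensional Hausdorff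
content. -/
structure IsSelfSimilar {X : Type*} [MetricSpace X] [Fintype A] (φ : A → X → X) (r : A → ℝ)
    (s : ℝ) (K : Set X) : Prop where
  r_pos : ∀ i, 0 < r i
  r_lt_one : ∀ i, r i < 1
  dist_map : ∀ i x y, dist (φ i x) (φ i y) = r i * dist x y
  isCompact : IsCompact K
  isConnected : IsConnected K
  eq_iUnion : K = ⋃ i, φ i '' K
  s_pos : 0 < s
  sum_rpow : ∑ i, r i ^ s = 1
  content_pos : 0 < hausdorffContent X s K

/-- The cylinder of a word `u` among the words of length `n`. -/
def cyl (n : ℕ) (u : List A) : Set (List.Vector A n) := {v | u <:+ v.1}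

namespace IsSelfSimilar

variable {X : Type*} [MetricSpace X] [Fintype A] {φ : A → X → X} {r : A → ℝ} {s : ℝ} {K : Set X}
  (h : IsSelfSimilar φ r s K)

include h

theorem wordRatio_pos (w : List A) : 0 < wordRatio r w := by
  induction w with
  | nil => simp
  | cons i w ih => rw [wordRatio_cons]; exact mul_pos (h.r_pos i) ih

theorem wordRatio_cons_le (i : A) (w : List A) : wordRatio r (i :: w) ≤ wordRatio r w := by
  rw [wordRatio_cons]
  exact mul_le_of_le_one_left (h.wordRatio_pos w).le (h.r_lt_one i).le

theorem wordRatio_le_of_suffix {u v : List A} (huv : u <:+ v) : wordRatio r v ≤ wordRatio r u := by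
  induction v with
  | nil => rw [List.suffix_nil.1 huv]
  | cons i v ih =>
    rcases List.suffix_cons_iff.1 huv with rfl | h'
    · rfl
    · exact (h.wordRatio_cons_le i v).trans (ih h')

theorem dist_wordMap (w : List A) (x y : X) :
    dist (wordMap φ w x) (wordMap φ w y) = wordRatio r w * dist x y := by
  induction w generalizing x y with
  | nil => simp [wordMap]
  | cons i w ih =>
    simp only [wordMap, Function.comp_apply, wordRatio_cons]
    rw [ih, h.dist_map]; ring

theorem continuous_wordMap (w : List A) : Continuous (wordMap φ w) :=
  (LipschitzWith.of_dist_le_mul (K := Real.toNNReal (wordRatio r w)) fun x y => by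
    rw [h.dist_wordMap, Real.coe_toNNReal _ (h.wordRatio_pos w).le]).continuous

theorem piece_nonempty (w : List A) : (piece φ K w).Nonempty := h.isConnected.nonempty.image _

theorem isClosed_piece (w : List A) : IsClosed (piece φ K w) :=
  (h.isCompact.image (h.continuous_wordMap w)).isClosed

theorem piece_eq_iUnion (w : List A) : piece φ K w = ⋃ i, piece φ K (i :: w) := by
  rw [piece]
  nth_rewrite 1 [h.eq_iUnion]
  rw [Set.image_iUnion]
  simp only [piece, wordMap, Set.image_comp]

theorem piece_subset_of_suffix {u v : List A} (huv : u <:+ v) : piece φ K v ⊆ piece φ K u := by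
  induction v with
  | nil => rw [List.suffix_nil.1 huv]
  | cons i v ih =>
    rcases List.suffix_cons_iff.1 huv with rfl | h'
    · rfl
    · refine subset_trans ?_ (ih h')
      rw [h.piece_eq_iUnion v]
      exact Set.subset_iUnion (fun i => piece φ K (i :: v)) i

/-- A piece is the union of the pieces of the words of length `n` in its cylinder. -/
theorem exists_mem_piece {u : List A} {n : ℕ} (hn : u.length ≤ n) {x : X} (hx : x ∈ piece φ K u) :
    ∃ v ∈ cyl n u, x ∈ piece φ K v.1 := by
  induction n, hn using Nat.le_induction with
  | base => exact ⟨⟨u, rfl⟩, List.suffix_rfl, hx⟩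
  | succ n _ ih =>
    obtain ⟨v, hv, hxv⟩ := ih
    rw [h.piece_eq_iUnion v.1, Set.mem_iUnion] at hxv
    obtain ⟨i, hi⟩ := hxv
    refine ⟨i ::ᵥ v, ?_, by rwa [List.Vector.cons_val]⟩
    rw [cyl, Set.mem_ofPred_eq, List.Vector.cons_val]
    exact List.IsSuffix.trans hv (List.suffix_cons i v.1)

/-- The pieces of the words of length `n` in a cylinder hang together. -/
theorem exists_inter_nonempty {u : List A} {n : ℕ} (hn : u.length ≤ n)
    {S : Set (List.Vector A n)} {v₀ w₀ : List.Vector A n} (hv₀ : v₀ ∈ cyl n u) (hv₀S : v₀ ∈ S)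
    (hw₀ : w₀ ∈ cyl n u) (hw₀S : w₀ ∉ S) :
    ∃ v ∈ cyl n u, ∃ w ∈ cyl n u, v ∈ S ∧ w ∉ S ∧ (piece φ K v.1 ∩ piece φ K w.1).Nonempty := by
  have hconn : IsPreconnected (piece φ K u) :=
    (h.isConnected.image _ (h.continuous_wordMap u).continuousOn).isPreconnected
  have hcl : ∀ Q : Set (List.Vector A n), IsClosed (⋃ v ∈ Q, piece φ K v.1) := fun Q =>
    (Set.toFinite Q).isClosed_biUnion fun v _ => h.isClosed_piece v.1
  obtain ⟨x, hxu, hx1, hx2⟩ := isPreconnected_closed_iff.1 hconn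
    (⋃ v ∈ cyl n u ∩ S, piece φ K v.1) (⋃ v ∈ cyl n u ∩ Sᶜ, piece φ K v.1) (hcl _) (hcl _)
    (by
      intro x hx
      obtain ⟨v, hv, hxv⟩ := h.exists_mem_piece hn hx
      by_cases hvS : v ∈ S
      · exact Or.inl (Set.mem_biUnion (show v ∈ cyl n u ∩ S from ⟨hv, hvS⟩) hxv)
      · exact Or.inr (Set.mem_biUnion (show v ∈ cyl n u ∩ Sᶜ from ⟨hv, hvS⟩) hxv))
    (by
      obtain ⟨x, hx⟩ := h.piece_nonempty v₀.1
      exact ⟨x, h.piece_subset_of_suffix hv₀ hx,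
        Set.mem_biUnion (show v₀ ∈ cyl n u ∩ S from ⟨hv₀, hv₀S⟩) hx⟩)
    (by
      obtain ⟨x, hx⟩ := h.piece_nonempty w₀.1
      exact ⟨x, h.piece_subset_of_suffix hw₀ hx,
        Set.mem_biUnion (show w₀ ∈ cyl n u ∩ Sᶜ from ⟨hw₀, hw₀S⟩) hx⟩)
  simp only [Set.mem_iUnion] at hx1 hx2
  obtain ⟨v, hv, hxv⟩ := hx1
  obtain ⟨w, hw, hxw⟩ := hx2
  exact ⟨v, hv.1, w, hw.1, hv.2, hw.2, x, hxv, hxw⟩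

theorem sum_wordRatio_rpow (n : ℕ) : ∑ v : List.Vector A n, wordRatio r v.1 ^ s = 1 := by
  induction n with
  | zero =>
    rw [Fintype.sum_eq_single (List.Vector.nil : List.Vector A 0)]
    · simp [List.Vector.nil]
    · intro v hv; exact absurd (Subsingleton.elim _ _) hv
  | succ n ih =>
    rw [sum_vector_succ, ← ih]
    refine Finset.sum_congr rfl fun w _ => ?_
    simp only [List.Vector.cons_val, wordRatio_cons]
    simp_rw [Real.mul_rpow (h.r_pos _).le (h.wordRatio_pos _).le]
    rw [← Finset.sum_mul, h.sum_rpow, one_mul]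

open Classical in
/-- The mass of a cylinder, when the word `v` carries the mass `wordRatio r v ^ s`. -/
theorem sum_cyl {u : List A} {n : ℕ} (hn : u.length ≤ n) :
    ∑ v with v ∈ cyl n u, wordRatio r v.1 ^ s = wordRatio r u ^ s := by
  induction n, hn using Nat.le_induction with
  | base =>
    obtain ⟨v₀, hv₀⟩ : ∃ v₀ : List.Vector A u.length, v₀.1 = u := ⟨⟨u, rfl⟩, rfl⟩
    have : (Finset.univ.filter fun v => v ∈ cyl u.length u) = {v₀} := by
      ext v
      rw [Finset.mem_filter, Finset.mem_singleton, cyl, Set.mem_ofPred_eq]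
      constructor
      · rintro ⟨-, hv⟩; exact Subtype.ext ((hv.eq_of_length v.2.symm).symm.trans hv₀.symm)
      · rintro rfl; exact ⟨Finset.mem_univ _, (congrArg (u <:+ ·) hv₀).mpr List.suffix_rfl⟩
    rw [this, Finset.sum_singleton, hv₀]
  | succ n hn ih =>
    rw [Finset.sum_filter, sum_vector_succ, ← ih, Finset.sum_filter]
    refine Finset.sum_congr rfl fun w _ => ?_
    have hiff : ∀ i, i ::ᵥ w ∈ cyl (n + 1) u ↔ w ∈ cyl n u := by
      intro i
      simp only [cyl, Set.mem_ofPred_eq, List.Vector.cons_val, List.suffix_cons_iff]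
      constructor
      · rintro (h' | h')
        · have h1 := congrArg List.length h'
          have h2 := w.2
          simp only [List.length_cons] at h1
          omega
        · exact h'
      · exact Or.inr
    simp only [hiff]
    split_ifs with hw
    · simp only [List.Vector.cons_val, wordRatio_cons]
      simp_rw [Real.mul_rpow (h.r_pos _).le (h.wordRatio_pos _).le]
      rw [← Finset.sum_mul, h.sum_rpow, one_mul]
    · simp

theorem exists_dist_le : ∃ Δ : ℝ, 0 < Δ ∧ ∀ w : List A, ∀ x ∈ piece φ K w, ∀ y ∈ piece φ K w,
    dist x y ≤ wordRatio r w * Δ := by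
  obtain ⟨C, hC⟩ := Metric.isBounded_iff.1 h.isCompact.isBounded
  refine ⟨max C 1, by positivity, ?_⟩
  rintro w _ ⟨x, hx, rfl⟩ _ ⟨y, hy, rfl⟩
  rw [h.dist_wordMap]
  exact mul_le_mul_of_nonneg_left ((hC hx hy).trans (le_max_left _ _)) (h.wordRatio_pos w).le

/-- The mass of a family of words is at most a constant times the `s`-th power of the diameter of
the union of their pieces. Indeed the content of `K` is at most the sum of that power and of the
contents of the other pieces, and these are scaled copies of `K`. -/
theorem exists_mass_le : ∃ κ : ℝ, 0 < κ ∧ ∀ (n : ℕ) (S : Finset (List.Vector A n)) (D : ℝ),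
    0 ≤ D →
    (∀ v ∈ S, ∀ w ∈ S, ∀ x ∈ piece φ K v.1, ∀ y ∈ piece φ K w.1, dist x y ≤ D) →
    κ * ∑ v ∈ S, wordRatio r v.1 ^ s ≤ D ^ s := by
  classical
  have hfin : hausdorffContent X s K ≠ ⊤ :=
    ne_top_of_le_ne_top (ENNReal.rpow_ne_top_of_nonneg h.s_pos.le h.isCompact.isBounded.ediam_ne_top)
      (hausdorffContent_le s K)
  refine ⟨(hausdorffContent X s K).toReal, ENNReal.toReal_pos h.content_pos.ne' hfin, ?_⟩
  intro n S D hD hS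
  set κ := hausdorffContent X s K with hκ
  have hcover : K ⊆ (⋃ v ∈ S, piece φ K v.1) ∪ ⋃ v ∈ Sᶜ, piece φ K v.1 := by
    intro x hx
    obtain ⟨v, -, hv⟩ := h.exists_mem_piece (u := []) (n := n) (by simp)
      (show x ∈ piece φ K [] by simpa [piece, wordMap] using hx)
    by_cases hvS : v ∈ S
    · exact Or.inl (Set.mem_biUnion hvS hv)
    · exact Or.inr (Set.mem_biUnion (by simpa using hvS) hv)
  have h1 : κ ≤ ENNReal.ofReal (D ^ s) +
      ∑ v ∈ Sᶜ, ENNReal.ofReal (wordRatio r v.1 ^ s) * κ := by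
    calc κ ≤ hausdorffContent X s ((⋃ v ∈ S, piece φ K v.1) ∪ ⋃ v ∈ Sᶜ, piece φ K v.1) :=
          measure_mono hcover
      _ ≤ hausdorffContent X s (⋃ v ∈ S, piece φ K v.1) +
          hausdorffContent X s (⋃ v ∈ Sᶜ, piece φ K v.1) := measure_union_le _ _
      _ ≤ _ := by
          refine add_le_add ?_ ((measure_biUnion_finset_le _ _).trans
            (Finset.sum_le_sum fun v _ => ?_))
          · refine (hausdorffContent_le s _).trans ?_
            rw [← ENNReal.ofReal_rpow_of_nonneg hD h.s_pos.le]
            refine ENNReal.rpow_le_rpow (Metric.ediam_le fun x hx y hy => ?_) h.s_pos.le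
            simp only [Set.mem_iUnion] at hx hy
            obtain ⟨v, hv, hxv⟩ := hx
            obtain ⟨w, hw, hyw⟩ := hy
            rw [edist_dist]
            exact ENNReal.ofReal_le_ofReal (hS v hv w hw x hxv y hyw)
          · exact hausdorffContent_image_le h.s_pos.le (h.wordRatio_pos v.1)
              (h.dist_wordMap v.1) K
  have hpos : ∀ v : List.Vector A n, 0 ≤ wordRatio r v.1 ^ s := fun v =>
    Real.rpow_nonneg (h.wordRatio_pos _).le _
  have h2 : κ.toReal ≤ D ^ s + (∑ v ∈ Sᶜ, wordRatio r v.1 ^ s) * κ.toReal := by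
    rw [← Finset.sum_mul, ← ENNReal.ofReal_sum_of_nonneg (fun v _ => hpos v),
      ← ENNReal.ofReal_toReal hfin, ← ENNReal.ofReal_mul (Finset.sum_nonneg fun v _ => hpos v),
      ← ENNReal.ofReal_add (by positivity)
        (mul_nonneg (Finset.sum_nonneg fun v _ => hpos v) ENNReal.toReal_nonneg)] at h1
    refine (ENNReal.ofReal_le_ofReal_iff ?_).1 h1
    exact add_nonneg (by positivity)
      (mul_nonneg (Finset.sum_nonneg fun v _ => hpos v) ENNReal.toReal_nonneg)
  have h3 := Finset.sum_add_sum_compl S fun v => wordRatio r v.1 ^ s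
  rw [h.sum_wordRatio_rpow n] at h3
  have h4 : ∑ v ∈ Sᶜ, wordRatio r v.1 ^ s = 1 - ∑ v ∈ S, wordRatio r v.1 ^ s := by linarith
  rw [h4] at h2
  linarith

end IsSelfSimilar

/-- The shortest suffix of `v` of ratio at most `δ`: the address of the piece of size about `δ`
that contains the piece of `v`. If `v` itself has a ratio above `δ`, then this is `v`. -/
noncomputable def cut (r : A → ℝ) (δ : ℝ) : List A → List A
  | [] => []
  | i :: v => open Classical in if wordRatio r v ≤ δ then cut r δ v else i :: v

theorem cut_suffix (r : A → ℝ) (δ : ℝ) (v : List A) : cut r δ v <:+ v := by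
  induction v with
  | nil => simp [cut]
  | cons i v ih =>
    rw [cut]; split_ifs
    · exact ih.trans (List.suffix_cons i v)
    · exact List.suffix_rfl

theorem wordRatio_cut_le {r : A → ℝ} {δ : ℝ} {v : List A} (hv : wordRatio r v ≤ δ) :
    wordRatio r (cut r δ v) ≤ δ := by
  induction v with
  | nil => simpa [cut] using hv
  | cons i v ih =>
    rw [cut]; split_ifs with h1
    · exact ih h1
    · exact hv

theorem lt_wordRatio_cut {r : A → ℝ} {ρ δ : ℝ} (hδ : 0 < δ) (hρ : 0 < ρ) (hr : ∀ i, ρ ≤ r i)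
    {v : List A} (hne : cut r δ v ≠ []) : ρ * δ < wordRatio r (cut r δ v) := by
  induction v with
  | nil => simp [cut] at hne
  | cons i v ih =>
    rw [cut] at hne ⊢
    split_ifs at hne ⊢ with h1
    · exact ih hne
    · rw [wordRatio_cons]
      have := hr i
      push Not at h1
      nlinarith

/-- The cylinders of the cut words form a partition: `cut r δ` is constant on each of them. -/
theorem cut_eq_of_suffix {A : Type*} [Fintype A] {X : Type*} [MetricSpace X] {φ : A → X → X}
    {r : A → ℝ} {s : ℝ} {K : Set X} (h : IsSelfSimilar φ r s K) {δ : ℝ} {v w : List A}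
    (hv : wordRatio r v ≤ δ) (hw : cut r δ v <:+ w) : cut r δ w = cut r δ v := by
  have hidem : ∀ v : List A, cut r δ (cut r δ v) = cut r δ v := by
    intro v
    induction v with
    | nil => simp [cut]
    | cons i v ih =>
      by_cases h1 : wordRatio r v ≤ δ
      · rw [cut, if_pos h1]; exact ih
      · have : cut r δ (i :: v) = i :: v := by rw [cut, if_neg h1]
        rw [this, this]
  induction w with
  | nil =>
    have := List.suffix_nil.1 hw
    rw [this]; simp [cut]
  | cons j w ih =>
    rcases List.suffix_cons_iff.1 hw with h1 | h1
    · rw [← h1, hidem]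
    · have h2 : wordRatio r w ≤ δ := (h.wordRatio_le_of_suffix h1).trans (wordRatio_cut_le hv)
      rw [cut, if_pos h2]; exact ih h1

theorem suffix_cut {A : Type*} [Fintype A] {X : Type*} [MetricSpace X] {φ : A → X → X}
    {r : A → ℝ} {s : ℝ} {K : Set X} (h : IsSelfSimilar φ r s K) {δ : ℝ} {u v : List A}
    (huv : u <:+ v) (hu : δ < wordRatio r u) : u <:+ cut r δ v := by
  induction v with
  | nil => simpa [cut] using huv
  | cons i v ih =>
    rw [cut]; split_ifs with h1
    · rcases List.suffix_cons_iff.1 huv with rfl | h2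
      · exact absurd (hu.trans_le ((h.wordRatio_cons_le i v).trans h1)) (lt_irrefl _)
      · exact ih h2
    · exact huv

end Words

/-! ### Trees on the words of a given length -/

/-- The first-level pieces have a branching: one of them meets three others. -/
def HasBranching {X A : Type*} (φ : A → X → X) (K : Set X) : Prop :=
  ∃ b c₁ c₂ c₃ : A, c₁ ≠ b ∧ c₂ ≠ b ∧ c₃ ≠ b ∧ c₁ ≠ c₂ ∧ c₁ ≠ c₃ ∧ c₂ ≠ c₃ ∧
    (φ b '' K ∩ φ c₁ '' K).Nonempty ∧ (φ b '' K ∩ φ c₂ '' K).Nonempty ∧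
    (φ b '' K ∩ φ c₃ '' K).Nonempty

/-- The breadth-first search tree of a connected graph. If some vertex has three neighbours, then
two vertices have the same depth: otherwise a vertex has at most one neighbour above it and at most
one below it. -/
theorem RTree.exists_of_connected {A : Type*} {G : SimpleGraph A} (hG : G.Connected)
    {b c₁ c₂ c₃ : A} (h₁₂ : c₁ ≠ c₂) (h₁₃ : c₁ ≠ c₃) (h₂₃ : c₂ ≠ c₃)
    (h₁ : G.Adj b c₁) (h₂ : G.Adj b c₂) (h₃ : G.Adj b c₃) (i : A) :
    ∃ τ : RTree A, τ.root = i ∧ (∀ j, j ≠ i → G.Adj j (τ.par j)) ∧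
      ∃ j k, j ≠ k ∧ τ.dep j = τ.dep k := by
  classical
  have hpar : ∀ j, j ≠ i → ∃ k, G.Adj j k ∧ G.dist i j = G.dist i k + 1 := by
    intro j hj
    obtain ⟨p, hp⟩ := hG.exists_walk_length_eq_dist j i
    cases p with
    | nil => exact absurd rfl hj
    | cons hadj q =>
      refine ⟨_, hadj, ?_⟩
      have h1 := SimpleGraph.dist_le q
      rw [SimpleGraph.Walk.length_cons] at hp
      rw [SimpleGraph.dist_comm (u := i), SimpleGraph.dist_comm (u := i), ← hp]
      have h2 := hG.dist_triangle (u := j) (v := _) (w := i) |>.trans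
        (Nat.add_le_add_right (le_of_eq (SimpleGraph.dist_eq_one_iff_adj.2 hadj)) _)
      omega
  choose! par hadj hdist using hpar
  refine ⟨⟨fun j => if j = i then i else par j, i, G.dist i, by simp, by simp, fun v hv => by
    simp only [hv, if_false]; exact hdist v hv⟩, rfl, fun j hj => by
    simp only [hj, if_false]; exact hadj j hj, ?_⟩
  by_contra! hne
  have hd : ∀ c, G.Adj b c → G.dist i c = G.dist i b + 1 ∨ G.dist i c + 1 = G.dist i b := by
    intro c hc
    have h3 := hG.dist_triangle (u := i) (v := b) (w := c)
    have h4 := hG.dist_triangle (u := i) (v := c) (w := b)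
    rw [SimpleGraph.dist_eq_one_iff_adj.2 hc] at h3
    rw [SimpleGraph.dist_eq_one_iff_adj.2 hc.symm] at h4
    have := hne b c hc.ne
    simp only at this
    omega
  have e₁ := hd c₁ h₁
  have e₂ := hd c₂ h₂
  have e₃ := hd c₃ h₃
  have n₁ := hne c₁ c₂ h₁₂
  have n₂ := hne c₁ c₃ h₁₃
  have n₃ := hne c₂ c₃ h₂₃
  simp only at n₁ n₂ n₃
  omega

/-- A tree on the words of length `n` whose edges join words with intersecting pieces, in which
every cylinder spans a subtree, and every cylinder contains two smaller ones such that neither lies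
below the other. -/
structure IsWordTree {X A : Type*} (φ : A → X → X) (K : Set X) (n : ℕ)
    (T : RTree (List.Vector A n)) : Prop where
  adj : ∀ v, (piece φ K v.1 ∩ piece φ K (T.par v).1).Nonempty
  anc_of_par_notMem : ∀ u v, v ∈ cyl n u → T.par v ∉ cyl n u → ∀ w ∈ cyl n u, T.Anc v w
  branch : ∀ u : List A, u.length < n → ∃ i j, ∀ v ∈ cyl n (i :: u), ∀ w ∈ cyl n (j :: u),
    T.par v ∉ cyl n (i :: u) → T.par w ∉ cyl n (j :: u) → ¬ T.Anc v w ∧ ¬ T.Anc w v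

theorem mem_cyl {A : Type*} {n : ℕ} {u : List A} {v : List.Vector A n} :
    v ∈ cyl n u ↔ u <:+ v.1 := Iff.rfl

theorem cons_mem_cyl {A : Type*} {n : ℕ} {u : List A} {i : A} {v : List.Vector A n} :
    i ::ᵥ v ∈ cyl (n + 1) u ↔ u = i :: v.1 ∨ v ∈ cyl n u := by
  rw [mem_cyl, mem_cyl, List.Vector.cons_val, List.suffix_cons_iff]

theorem length_le_of_mem_cyl {A : Type*} {n : ℕ} {u : List A} {v : List.Vector A n}
    (h : v ∈ cyl n u) : u.length ≤ n := by
  have := List.IsSuffix.length_le (mem_cyl.1 h)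
  rwa [v.2] at this

section Refine

variable {A : Type*} {n : ℕ} (T : RTree (List.Vector A n)) (τ : A → RTree A)
  (en ex : List.Vector A n → A)

/-- The refinement of a tree on words of length `n`: each vertex `v` is replaced by a copy of the
tree `τ (en v)` on the alphabet, and the edge from `v` to its parent joins the root of this copy to
the letter `ex v` of the copy of the parent. -/
noncomputable def RTree.refine (hτ : ∀ i, (τ i).root = i) : RTree (List.Vector A (n + 1)) where
  par x := open Classical in
    if x.head = en x.tail then
      if x.tail = T.root then x else ex x.tail ::ᵥ T.par x.tail
    else (τ (en x.tail)).par x.head ::ᵥ x.tail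
  root := en T.root ::ᵥ T.root
  dep x := (∑ k ∈ Finset.range (T.dep x.tail),
    ((τ (en (T.par^[k + 1] x.tail))).dep (ex (T.par^[k] x.tail)) + 1)) +
      (τ (en x.tail)).dep x.head
  par_root := by simp
  dep_root := by
    have := (τ (en T.root)).dep_root
    rw [hτ] at this
    simp [T.dep_root, this]
  dep_par := by
    intro x hx
    obtain ⟨i, v, rfl⟩ := x.exists_eq_cons
    have h0 := (τ (en v)).dep_root
    rw [hτ] at h0
    by_cases hi : i = en v
    · have hv : v ≠ T.root := by rintro rfl; exact hx (by rw [hi])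
      rw [if_pos (by simp [hi]), if_neg (by simpa using hv)]
      simp only [List.Vector.head_cons, List.Vector.tail_cons]
      rw [hi, h0, T.dep_par v hv, Finset.sum_range_succ']
      simp only [Function.iterate_succ_apply, Function.iterate_zero, id]
      ring
    · rw [if_neg (by simpa using hi)]
      simp only [List.Vector.head_cons, List.Vector.tail_cons]
      have := (τ (en v)).dep_par i (by rwa [hτ])
      omega

variable {T τ en ex} {hτ : ∀ i, (τ i).root = i}

theorem RTree.refine_par_of_ne {i : A} {v : List.Vector A n} (hi : i ≠ en v) :
    (T.refine τ en ex hτ).par (i ::ᵥ v) = (τ (en v)).par i ::ᵥ v := by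
  simp [RTree.refine, hi]

theorem RTree.refine_par_entry {v : List.Vector A n} (hv : v ≠ T.root) :
    (T.refine τ en ex hτ).par (en v ::ᵥ v) = ex v ::ᵥ T.par v := by
  simp [RTree.refine, hv]

theorem RTree.refine_par_root :
    (T.refine τ en ex hτ).par (en T.root ::ᵥ T.root) = en T.root ::ᵥ T.root :=
  (T.refine τ en ex hτ).par_root

theorem RTree.refine_anc_entry (i : A) (v : List.Vector A n) :
    (T.refine τ en ex hτ).Anc (en v ::ᵥ v) (i ::ᵥ v) := by
  induction hd : (τ (en v)).dep i generalizing i with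
  | zero =>
    have := RTree.eq_root_of_dep_eq_zero hd
    rw [hτ] at this
    rw [this]; exact RTree.Anc.refl _
  | succ d ih =>
    have hi : i ≠ en v := by
      rintro rfl
      have := (τ (en v)).dep_root
      rw [hτ] at this
      omega
    have h1 := (τ (en v)).dep_par i (by rwa [hτ])
    have h2 := RTree.anc_par (T := T.refine τ en ex hτ) (i ::ᵥ v)
    rw [RTree.refine_par_of_ne hi] at h2
    exact (ih _ (by omega)).trans h2

theorem RTree.refine_anc {v w : List.Vector A n} (h : T.Anc v w) (j : A) :
    (T.refine τ en ex hτ).Anc (en v ::ᵥ v) (j ::ᵥ w) := by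
  obtain ⟨k, hk⟩ := h
  induction k generalizing w j with
  | zero => obtain rfl : w = v := hk; exact RTree.refine_anc_entry j w
  | succ k ih =>
    by_cases hw : w = T.root
    · rw [hw, RTree.iterate_root] at hk
      rw [← hk, hw]; exact RTree.refine_anc_entry j _
    · rw [Function.iterate_succ_apply] at hk
      have h1 := ih (w := T.par w) (ex w) hk
      rw [← RTree.refine_par_entry (τ := τ) (en := en) (ex := ex) (hτ := hτ) hw] at h1
      exact (h1.trans (RTree.anc_par _)).trans (RTree.refine_anc_entry j w)

theorem RTree.anc_tail_of_refine_anc {x y : List.Vector A (n + 1)}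
    (h : (T.refine τ en ex hτ).Anc x y) : T.Anc x.tail y.tail := by
  obtain ⟨k, rfl⟩ := h
  induction k with
  | zero => exact RTree.Anc.refl _
  | succ k ih =>
    rw [Function.iterate_succ_apply']
    refine RTree.Anc.trans ?_ ih
    obtain ⟨i, v, hx⟩ := List.Vector.exists_eq_cons ((T.refine τ en ex hτ).par^[k] y)
    rw [hx]
    by_cases hi : i = en v
    · subst hi
      by_cases hv : v = T.root
      · subst hv; rw [RTree.refine_par_root]; exact RTree.Anc.refl _
      · rw [RTree.refine_par_entry hv]
        simp only [List.Vector.tail_cons]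
        exact RTree.anc_par v
    · rw [RTree.refine_par_of_ne hi]
      simp only [List.Vector.tail_cons]
      exact RTree.Anc.refl _

/-- The top of a cylinder in a refined tree comes from the top of the cylinder in the tree. -/
theorem RTree.refine_top {u : List A} {i : A} {v : List.Vector A n} (hv : v ∈ cyl n u)
    (hpar : (T.refine τ en ex hτ).par (i ::ᵥ v) ∉ cyl (n + 1) u) :
    i = en v ∧ T.par v ∉ cyl n u := by
  by_cases hi : i = en v
  · subst hi
    refine ⟨rfl, fun h => ?_⟩
    by_cases hv' : v = T.root
    · subst hv'
      rw [RTree.refine_par_root] at hpar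
      exact hpar (cons_mem_cyl.2 (Or.inr hv))
    · rw [RTree.refine_par_entry hv'] at hpar
      exact hpar (cons_mem_cyl.2 (Or.inr h))
  · rw [RTree.refine_par_of_ne hi] at hpar
    exact absurd (cons_mem_cyl.2 (Or.inr hv)) hpar

end Refine

namespace IsSelfSimilar

variable {X : Type*} [MetricSpace X] {A : Type*} [Fintype A] {φ : A → X → X} {r : A → ℝ} {s : ℝ}
  {K : Set X} (h : IsSelfSimilar φ r s K)

include h

/-- By connectedness of `K`, the letters carry a tree with any given root whose edges join letters
with intersecting pieces. If there is a branching, then the tree is not a path starting at its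
root. -/
theorem exists_letter_tree (hb : HasBranching φ K) (i : A) :
    ∃ τ : RTree A, τ.root = i ∧ (∀ j, (φ j '' K ∩ φ (τ.par j) '' K).Nonempty) ∧
      ∃ j k, j ≠ k ∧ τ.dep j = τ.dep k := by
  let G : SimpleGraph A :=
    { Adj := fun a b => a ≠ b ∧ (φ a '' K ∩ φ b '' K).Nonempty
      symm := ⟨fun a b hab => ⟨hab.1.symm, by rw [Set.inter_comm]; exact hab.2⟩⟩
      loopless := ⟨fun a ha => ha.1 rfl⟩ }
  have hG : G.Connected := by
    have : Nonempty A := ⟨i⟩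
    refine ⟨fun a b => ?_⟩
    by_contra hab
    obtain ⟨v, -, w, -, hv, hw, hvw⟩ := h.exists_inter_nonempty (u := []) (n := 1) (by simp)
      (S := {v | G.Reachable a v.head}) (v₀ := a ::ᵥ List.Vector.nil)
      (w₀ := b ::ᵥ List.Vector.nil) List.nil_suffix
      (by simp only [Set.mem_ofPred_eq, List.Vector.head_cons]; rfl) List.nil_suffix
      (by simpa using hab)
    obtain ⟨c, v, rfl⟩ := v.exists_eq_cons
    obtain ⟨d, w, rfl⟩ := w.exists_eq_cons
    obtain rfl : v = List.Vector.nil := Subsingleton.elim _ _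
    obtain rfl : w = List.Vector.nil := Subsingleton.elim _ _
    simp only [Set.mem_ofPred_eq, List.Vector.head_cons] at hv hw
    refine hw (hv.trans ?_)
    by_cases hcd : c = d
    · rw [hcd]
    · exact SimpleGraph.Adj.reachable (show G.Adj c d from ⟨hcd, by
        simpa [piece, wordMap, List.Vector.nil] using hvw⟩)
  obtain ⟨b, c₁, c₂, c₃, n₁, n₂, n₃, h₁₂, h₁₃, h₂₃, m₁, m₂, m₃⟩ := hb
  obtain ⟨τ, hroot, hadj, hjk⟩ := RTree.exists_of_connected hG h₁₂ h₁₃ h₂₃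
    (show G.Adj b c₁ from ⟨n₁.symm, m₁⟩) (show G.Adj b c₂ from ⟨n₂.symm, m₂⟩)
    (show G.Adj b c₃ from ⟨n₃.symm, m₃⟩) i
  refine ⟨τ, hroot, fun j => ?_, hjk⟩
  by_cases hj : j = i
  · rw [hj, ← hroot, τ.par_root, Set.inter_self]
    exact h.isConnected.nonempty.image _
  · exact (hadj j hj).2

/-- If the first-level pieces have a branching, then the words of any given length carry a tree
that is adapted to the cylinders and branches within each of them. -/
theorem exists_isWordTree (hb : HasBranching φ K) (n : ℕ) :
    ∃ T : RTree (List.Vector A n), IsWordTree φ K n T := by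
  choose τ hτ hτadj hτbr using h.exists_letter_tree hb
  induction n with
  | zero =>
    refine ⟨⟨id, List.Vector.nil, fun _ => 0, rfl, rfl, fun v hv =>
      absurd (Subsingleton.elim _ _) hv⟩, ⟨fun v => ?_, fun u v hv hv' => absurd hv hv',
      fun u hu => by omega⟩⟩
    simpa using h.piece_nonempty v.1
  | succ n ih =>
    obtain ⟨T, hT⟩ := ih
    have hedge : ∀ v, ∃ a b, (piece φ K (a :: v.1) ∩ piece φ K (b :: (T.par v).1)).Nonempty := by
      intro v
      obtain ⟨x, hx1, hx2⟩ := hT.adj v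
      rw [h.piece_eq_iUnion, Set.mem_iUnion] at hx1 hx2
      obtain ⟨a, ha⟩ := hx1
      obtain ⟨b, hb⟩ := hx2
      exact ⟨a, b, x, ha, hb⟩
    choose en ex hedge using hedge
    refine ⟨T.refine τ en ex hτ, ?_, ?_, ?_⟩
    · intro x
      obtain ⟨i, v, rfl⟩ := x.exists_eq_cons
      by_cases hi : i = en v
      · subst hi
        by_cases hv : v = T.root
        · subst hv
          rw [RTree.refine_par_root, Set.inter_self]
          exact h.piece_nonempty _
        · rw [RTree.refine_par_entry hv, List.Vector.cons_val, List.Vector.cons_val]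
          exact hedge v
      · rw [RTree.refine_par_of_ne hi, List.Vector.cons_val, List.Vector.cons_val]
        obtain ⟨_, ⟨y, hy, rfl⟩, ⟨z, hz, hzy⟩⟩ := hτadj (en v) i
        refine ⟨wordMap φ v.1 (φ i y), ⟨y, hy, rfl⟩, ⟨z, hz, ?_⟩⟩
        simp only [wordMap, Function.comp_apply, hzy]
    · intro u x hx hpar y hy
      obtain ⟨i, v, rfl⟩ := x.exists_eq_cons
      obtain ⟨j, w, rfl⟩ := y.exists_eq_cons
      rcases cons_mem_cyl.1 hx with hu | hv
      · have hxy : i ::ᵥ v = j ::ᵥ w := by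
          refine Subtype.ext (List.IsSuffix.eq_of_length ?_ ?_)
          · have := mem_cyl.1 hy
            rwa [hu, ← List.Vector.cons_val] at this
          · rw [(i ::ᵥ v).2, (j ::ᵥ w).2]
        rw [hxy]; exact RTree.Anc.refl _
      · obtain ⟨rfl, hpv⟩ := RTree.refine_top hv hpar
        rcases cons_mem_cyl.1 hy with hu | hw
        · have h1 := length_le_of_mem_cyl hv
          rw [hu, List.length_cons, w.2] at h1
          omega
        · exact RTree.refine_anc (hT.anc_of_par_notMem u v hv hpv w hw) j
    · intro u hu
      rcases Nat.lt_succ_iff_lt_or_eq.1 hu with hlt | heq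
      · obtain ⟨i, j, hij⟩ := hT.branch u hlt
        refine ⟨i, j, fun x hx y hy hpx hpy => ?_⟩
        obtain ⟨a, v, rfl⟩ := x.exists_eq_cons
        obtain ⟨b, w, rfl⟩ := y.exists_eq_cons
        have hmem : ∀ (a i : A) (v : List.Vector A n), a ::ᵥ v ∈ cyl (n + 1) (i :: u) →
            v ∈ cyl n (i :: u) := by
          intro a i v hv
          rcases cons_mem_cyl.1 hv with h1 | h1
          · have h2 := congrArg List.length h1
            simp only [List.length_cons] at h2
            have := v.2
            omega
          · exact h1
        have hv := hmem _ _ _ hx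
        have hw := hmem _ _ _ hy
        obtain ⟨-, hpv⟩ := RTree.refine_top hv hpx
        obtain ⟨-, hpw⟩ := RTree.refine_top hw hpy
        have h1 := hij v hv w hw hpv hpw
        refine ⟨fun h2 => h1.1 ?_, fun h2 => h1.2 ?_⟩ <;>
        simpa using RTree.anc_tail_of_refine_anc h2
      · obtain ⟨v₀, hv₀⟩ : ∃ v₀ : List.Vector A n, v₀.1 = u := ⟨⟨u, heq⟩, rfl⟩
        obtain ⟨j, k, hjk, hdep⟩ := hτbr (en v₀)
        have hsing : ∀ (a : A) (x : List.Vector A (n + 1)), x ∈ cyl (n + 1) (a :: u) →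
            x = a ::ᵥ v₀ := by
          intro a x hx
          refine Subtype.ext (List.IsSuffix.eq_of_length ?_ ?_).symm
          · rw [List.Vector.cons_val, hv₀]; exact hx
          · rw [(a ::ᵥ v₀).2, x.2]
        refine ⟨j, k, fun x hx y hy _ _ => ?_⟩
        rw [hsing j x hx, hsing k y hy]
        have hd : (T.refine τ en ex hτ).dep (j ::ᵥ v₀) = (T.refine τ en ex hτ).dep (k ::ᵥ v₀) := by
          simp [RTree.refine, hdep]
        have hne : j ::ᵥ v₀ ≠ k ::ᵥ v₀ := fun h1 => hjk (by
          simpa using congrArg List.Vector.head h1)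
        exact ⟨fun h1 => hne (h1.eq_of_dep_eq hd), fun h1 => hne (h1.eq_of_dep_eq hd.symm).symm⟩

end IsSelfSimilar

/-! ### Branches of a path in a tree -/

namespace RTree

variable {V : Type*} {T : RTree V}

/-- Somewhere on the path from an ancestor in `S` to a descendant outside `S`, the path leaves
`S`. -/
theorem Anc.exists_exit {S : Set V} {q x : V} (h : T.Anc q x) (hq : q ∈ S) (hx : x ∉ S) :
    ∃ y, y ∉ S ∧ T.par y ∈ S ∧ T.Anc q (T.par y) ∧ T.Anc y x := by
  obtain ⟨k, rfl⟩ := h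
  induction k with
  | zero => exact absurd hq hx
  | succ k ih =>
    by_cases hk : T.par^[k] x ∈ S
    · obtain ⟨y, h1, h2, h3, h4⟩ := ih hk
      refine ⟨y, h1, h2, ?_, h4⟩
      rw [Function.iterate_succ_apply']
      exact (RTree.anc_par _).trans h3
    · rw [Function.iterate_succ_apply'] at hq ⊢
      exact ⟨_, hk, hq, Anc.refl _, ⟨k, rfl⟩⟩

/-- There is an order of the siblings for which the following holds. Consider a path that always
descends to the child with the largest value of `sc`, and two of its vertices at which the
second largest values have the same label `g`. Then the path has, on its left as well as on its
right, a branch whose value has the label `g`.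

The child with the largest value is put last or first according to the parity of the number of
proper ancestors with the same label, so that the second largest child changes sides between
consecutive vertices with the same label. -/
theorem exists_alternating_order [Fintype V] (T : RTree V) (sc : V → ℝ) (lab : ℝ → ℤ) :
    ∃ rk : V → ℕ,
      (∀ c c' p, T.IsChild c p → T.IsChild c' p → rk c = rk c' → c = c') ∧
      ∀ (g : ℤ) (p c p' c' : V), T.IsChild c p → T.Anc c p' → T.IsChild c' p' →
        (∀ q d, T.Anc p q → T.IsChild d q → T.Anc d c' →
          ∀ d', T.IsChild d' q → d' ≠ d → sc d' < sc d) →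
        (∃ d, T.IsChild d p ∧ d ≠ c ∧ lab (sc d) = g ∧
          ∀ d', T.IsChild d' p → d' ≠ c → sc d' ≤ sc d) →
        (∃ d, T.IsChild d p' ∧ d ≠ c' ∧ lab (sc d) = g ∧
          ∀ d', T.IsChild d' p' → d' ≠ c' → sc d' ≤ sc d) →
        (∃ q d e, T.Anc p q ∧ T.IsChild d q ∧ T.Anc d c' ∧ T.IsChild e q ∧ rk e < rk d ∧
          lab (sc e) = g) ∧
        (∃ q d e, T.Anc p q ∧ T.IsChild d q ∧ T.Anc d c' ∧ T.IsChild e q ∧ rk d < rk e ∧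
          lab (sc e) = g) := by
  classical
  have hmax : ∀ s : Finset V, ∃ a, s.Nonempty → a ∈ s ∧ ∀ b ∈ s, sc b ≤ sc a := by
    intro s
    rcases s.eq_empty_or_nonempty with rfl | hs
    · exact ⟨T.root, fun h => absurd h Finset.not_nonempty_empty⟩
    · obtain ⟨a, ha⟩ := s.exists_max_image sc hs
      exact ⟨a, fun _ => ha⟩
  choose am ham using hmax
  let hv : V → V := fun p => am (T.children p)
  let rest : V → Finset V := fun p => (T.children p).erase (hv p)
  let cls : V → Option ℤ := fun p =>
    if (rest p).Nonempty then some (lab (sc (am (rest p)))) else none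
  let cnt : V → Finset V := fun p =>
    Finset.univ.filter fun a => a ≠ p ∧ T.Anc a p ∧ cls a = cls p
  let e := Fintype.equivFin V
  let rk : V → ℕ := fun c =>
    if c = hv (T.par c) then (if Even (cnt (T.par c)).card then Fintype.card V + 1 else 0)
    else (e c : ℕ) + 1
  have hrk_hv : ∀ p, T.IsChild (hv p) p →
      rk (hv p) = if Even (cnt p).card then Fintype.card V + 1 else 0 := by
    intro p hp
    simp only [rk, hp.2, if_true]
  have hrk_ne : ∀ p c, T.IsChild c p → c ≠ hv p → rk c = (e c : ℕ) + 1 := by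
    intro p c hc hne
    simp only [rk, hc.2, hne, if_false]
  refine ⟨rk, ?_, ?_⟩
  · intro c c' p hc hc' heq
    have hlt : ∀ v, (e v : ℕ) < Fintype.card V := fun v => (e v).2
    by_cases h1 : c = hv p <;> by_cases h2 : c' = hv p
    · rw [h1, h2]
    · rw [hrk_ne p c' hc' h2, h1, hrk_hv p (h1 ▸ hc)] at heq
      have := hlt c'
      split_ifs at heq
      all_goals omega
    · rw [hrk_ne p c hc h1, h2, hrk_hv p (h2 ▸ hc')] at heq
      have := hlt c
      split_ifs at heq
      all_goals omega
    · rw [hrk_ne p c hc h1, hrk_ne p c' hc' h2] at heq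
      exact e.injective (Fin.ext (by omega))
  intro g p c p' c' hc hcp' hc' hheavy hp hp'
  have hpc' : T.Anc p p' := hc.anc.trans hcp'
  have hhv : ∀ q d, T.Anc p q → T.IsChild d q → T.Anc d c' → hv q = d := by
    intro q d hpq hd hdc'
    obtain ⟨h1, h2⟩ := ham (T.children q) ⟨d, mem_children.2 hd⟩
    by_contra hne
    have h3 := hheavy q d hpq hd hdc' (hv q) (mem_children.1 h1) hne
    exact absurd (h2 d (mem_children.2 hd)) (not_le.2 h3)
  have hcls : ∀ q d, T.Anc p q → T.IsChild d q → T.Anc d c' →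
      (∃ a, T.IsChild a q ∧ a ≠ d ∧ lab (sc a) = g ∧
        ∀ d', T.IsChild d' q → d' ≠ d → sc d' ≤ sc a) → cls q = some g := by
    rintro q d hpq hd hdc' ⟨a, ha, had, hag, hamax⟩
    have hq := hhv q d hpq hd hdc'
    have hmem : a ∈ rest q := Finset.mem_erase.2 ⟨hq ▸ had, mem_children.2 ha⟩
    obtain ⟨h1, h2⟩ := ham (rest q) ⟨a, hmem⟩
    have h3 := Finset.mem_erase.1 h1
    have h4 : sc (am (rest q)) = sc a :=
      le_antisymm (hamax _ (mem_children.1 h3.2) (hq ▸ h3.1)) (h2 a hmem)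
    simp only [cls]
    rw [if_pos ⟨a, hmem⟩, h4, hag]
  have hclsp : cls p = some g := hcls p c (Anc.refl p) hc (hcp'.trans hc'.anc) hp
  have hclsp' : cls p' = some g := hcls p' c' hpc' hc' (Anc.refl c') hp'
  have hpne : p ≠ p' := by rintro rfl; exact hc.not_anc hcp'
  -- the next vertex on the path with the label `g`
  obtain ⟨q, hq, hqmin⟩ := Finset.exists_min_image
    (Finset.univ.filter fun q => q ≠ p ∧ T.Anc p q ∧ T.Anc q p' ∧ cls q = some g) T.dep
    ⟨p', by simp [hpne.symm, hpc', hclsp', Anc.refl]⟩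
  simp only [Finset.mem_filter, Finset.mem_univ, true_and] at hq hqmin
  obtain ⟨hqp, hpq, hqp', hclsq⟩ := hq
  have hcnt : cnt q = insert p (cnt p) := by
    ext a
    simp only [cnt, Finset.mem_filter, Finset.mem_univ, true_and, Finset.mem_insert, hclsq, hclsp]
    constructor
    · rintro ⟨haq, haq', hcla⟩
      by_cases hap : a = p
      · exact Or.inl hap
      · refine Or.inr ⟨hap, ?_, hcla⟩
        rcases Anc.total haq' hpq with h1 | h1
        · exact h1
        · have h2 := hqmin a ⟨hap, h1, haq'.trans hqp', hcla⟩
          exact absurd (haq'.eq_of_dep_eq (le_antisymm haq'.dep_le h2)) haq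
    · rintro (rfl | ⟨hap, hap', hcla⟩)
      · exact ⟨hqp.symm, hpq, hclsp⟩
      · refine ⟨?_, hap'.trans hpq, hcla⟩
        rintro rfl
        exact hqp (hap'.antisymm hpq)
  have hparity : Even (cnt q).card ↔ ¬ Even (cnt p).card := by
    rw [hcnt, Finset.card_insert_of_notMem (by simp [cnt]), Nat.even_add_one]
  have hside : ∀ q d, T.Anc p q → T.IsChild d q → T.Anc d c' → cls q = some g →
      ∃ e, T.IsChild e q ∧ lab (sc e) = g ∧
        (Even (cnt q).card → rk e < rk d) ∧ (¬ Even (cnt q).card → rk d < rk e) := by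
    intro q d hpq hd hdc' hq
    have hqd := hhv q d hpq hd hdc'
    simp only [cls] at hq
    split_ifs at hq with hne
    have h1 := Finset.mem_erase.1 (ham (rest q) hne).1
    have h2 := mem_children.1 h1.2
    refine ⟨am (rest q), h2, Option.some.inj hq, ?_, ?_⟩ <;>
    · intro hev
      rw [hrk_ne q _ h2 h1.1, ← hqd, hrk_hv q (hqd ▸ hd)]
      have := (e (am (rest q))).2
      simp only [hev, if_true, if_false]
      omega
  obtain ⟨b, hb, hbg, hb1, hb2⟩ := hside p c (Anc.refl p) hc (hcp'.trans hc'.anc) hclsp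
  have hqc' : q ≠ c' := by rintro rfl; exact hc'.not_anc hqp'
  obtain ⟨d, hd, hdc'⟩ := (hqp'.trans hc'.anc).exists_child hqc'
  obtain ⟨b', hb', hb'g, hb'1, hb'2⟩ := hside q d hpq hd hdc' hclsq
  by_cases hev : Even (cnt p).card
  · exact ⟨⟨p, c, b, Anc.refl p, hc, hcp'.trans hc'.anc, hb, hb1 hev, hbg⟩,
      ⟨q, d, b', hpq, hd, hdc', hb', hb'2 (by rw [hparity]; exact not_not.2 hev), hb'g⟩⟩
  · exact ⟨⟨q, d, b', hpq, hd, hdc', hb', hb'1 (hparity.2 hev), hb'g⟩,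
      ⟨p, c, b, Anc.refl p, hc, hcp'.trans hc'.anc, hb, hb2 hev, hbg⟩⟩

/-- Branches that hang off a path at distinct vertices are disjoint. -/
theorem eq_of_anc_of_not_anc {y p p' c c' v : V} (hp : T.Anc p y) (hp' : T.Anc p' y)
    (hc : T.IsChild c p) (hc' : T.IsChild c' p') (hcy : ¬ T.Anc c y) (hcy' : ¬ T.Anc c' y)
    (hv : T.Anc c v) (hv' : T.Anc c' v) : p = p' := by
  have key : ∀ p p' c c' : V, T.Anc p' y → T.IsChild c p → T.IsChild c' p' →
      ¬ T.Anc c y → T.Anc c v → T.Anc c' v → T.Anc p p' → p = p' := by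
    intro p p' c c' hp' hc hc' hcy hv hv' hpp'
    by_contra hne
    obtain ⟨d, hd, hdp'⟩ := hpp'.exists_child hne
    have : d = c := hd.eq_of_anc hc ((hdp'.trans hc'.anc).trans hv') hv
    exact hcy (this ▸ hdp'.trans hp')
  rcases Anc.total hp hp' with h | h
  · exact key p p' c c' hp' hc hc' hcy hv hv' h
  · exact (key p' p c' c hp hc' hc hcy' hv' hv h).symm

end RTree

namespace IsWordTree

variable {X : Type*} {A : Type*} {φ : A → X → X} {K : Set X} {n : ℕ} {T : RTree (List.Vector A n)}
  (hT : IsWordTree φ K n T)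

include hT

/-- A cylinder contains the path between any two of its vertices on the same branch. -/
theorem mem_cyl_of_anc {u : List A} {v w p : List.Vector A n} (hv : v ∈ cyl n u) (hw : w ∈ cyl n u)
    (hvp : T.Anc v p) (hpw : T.Anc p w) : p ∈ cyl n u := by
  by_contra hp
  obtain ⟨y, hy1, hy2, hy3, -⟩ := hpw.exists_exit (S := (cyl n u)ᶜ) hp (fun h => h hw)
  rw [Set.mem_compl_iff, not_not] at hy1
  have h1 := hT.anc_of_par_notMem u y hy1 hy2 v hv
  have h2 : y ≠ T.root := by
    rintro rfl
    rw [T.par_root] at hy2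
    exact hy2 hy1
  have h3 := h1.dep_le
  have h4 := (hvp.trans hy3).dep_le
  have h5 := T.dep_par y h2
  omega

/-- A path that enters a cylinder has a branch, hanging off at a vertex of this cylinder, that
contains a whole cylinder of the next generation. Indeed of the two subcylinders of which neither
lies below the other, the path avoids at least one. -/
theorem exists_branch {u : List A} (hu : u.length < n) {z y q : List.Vector A n} (hzq : T.Anc z q)
    (hqy : T.Anc q y) (hz : z ∉ cyl n u) (hq : q ∈ cyl n u)
    (hne : ∀ i, (cyl n (i :: u)).Nonempty) :
    ∃ p, T.Anc z p ∧ T.Anc p y ∧ p ∈ cyl n u ∧ ∃ c i, T.IsChild c p ∧ ¬ T.Anc c y ∧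
      ∀ w ∈ cyl n (i :: u), T.Anc c w := by
  classical
  have hsub : ∀ i, cyl n (i :: u) ⊆ cyl n u := fun i v hv =>
    (List.suffix_cons i u).trans hv
  have hi : ∃ i, ∀ v ∈ cyl n (i :: u), T.Anc z v → ¬ T.Anc v y := by
    obtain ⟨i, j, hij⟩ := hT.branch u hu
    by_contra! hall
    obtain ⟨v, hv, hzv, hvy⟩ := hall i
    obtain ⟨w, hw, hzw, hwy⟩ := hall j
    obtain ⟨t, ht1, ht2, -, ht4⟩ := hzv.exists_exit (S := (cyl n (i :: u))ᶜ)
      (fun h => hz (hsub i h)) (fun h => h hv)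
    obtain ⟨t', ht1', ht2', -, ht4'⟩ := hzw.exists_exit (S := (cyl n (j :: u))ᶜ)
      (fun h => hz (hsub j h)) (fun h => h hw)
    rw [Set.mem_compl_iff, not_not] at ht1 ht1'
    have h1 := hij t ht1 t' ht1' ht2 ht2'
    rcases RTree.Anc.total (ht4.trans hvy) (ht4'.trans hwy) with h2 | h2
    · exact h1.1 h2
    · exact h1.2 h2
  obtain ⟨i, hi⟩ := hi
  obtain ⟨x, hx⟩ := hne i
  obtain ⟨t, ht1, ht2, ht3, ht4⟩ := hzq.exists_exit (S := (cyl n u)ᶜ) hz (fun h => h hq)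
  rw [Set.mem_compl_iff, not_not] at ht1
  have htx : T.Anc t x := hT.anc_of_par_notMem u t ht1 ht2 x (hsub i hx)
  have hzt : T.Anc z t := ht3.trans (RTree.anc_par t)
  obtain ⟨p, hp, hpmax⟩ := Finset.exists_max_image
    (Finset.univ.filter fun p : Fin (T.dep y + 1) =>
      T.Anc z (T.par^[(p : ℕ)] y) ∧ T.Anc (T.par^[(p : ℕ)] y) x)
    (fun p => T.dep (T.par^[(p : ℕ)] y))
    ⟨⟨T.dep y - T.dep t, by omega⟩, by
      simp only [Finset.mem_filter, Finset.mem_univ, true_and]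
      rw [(ht4.trans hqy).iterate_eq]
      exact ⟨hzt, htx⟩⟩
  simp only [Finset.mem_filter, Finset.mem_univ, true_and] at hp hpmax
  have hpmax' : ∀ a, T.Anc z a → T.Anc a y → T.Anc a x → T.dep a ≤ T.dep (T.par^[(p : ℕ)] y) := by
    intro a h1 h2 h3
    have h4 := hpmax ⟨T.dep y - T.dep a, by omega⟩
    simp only [h2.iterate_eq] at h4
    exact h4 ⟨h1, h3⟩
  have hpy : T.Anc (T.par^[(p : ℕ)] y) y := ⟨p, rfl⟩
  generalize T.par^[(p : ℕ)] y = p₀ at hp hpmax' hpy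
  clear hpmax
  have hpx : p₀ ≠ x := by rintro rfl; exact hi _ hx hp.1 hpy
  obtain ⟨c, hc, hcx⟩ := hp.2.exists_child hpx
  have htp : T.Anc t p₀ := htx.anc_of_dep_le hp.2 (hpmax' t hzt (ht4.trans hqy) htx)
  refine ⟨p₀, hp.1, hpy, hT.mem_cyl_of_anc ht1 (hsub i hx) htp hp.2, c, i, hc, ?_, ?_⟩
  · intro hcy
    have := hpmax' c (hp.1.trans hc.anc) hcy hcx
    have := hc.dep
    omega
  · intro w hw
    obtain ⟨t', ht1', ht2', ht3', ht4'⟩ := hp.2.exists_exit (S := (cyl n (i :: u))ᶜ)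
      (fun h => hi _ h hp.1 hpy) (fun h => h hx)
    rw [Set.mem_compl_iff, not_not] at ht1'
    refine RTree.Anc.trans ?_ (hT.anc_of_par_notMem _ t' ht1' ht2' w hw)
    refine hcx.anc_of_dep_le ht4' ?_
    have h1 := ht3'.dep_le
    have h2 := hc.dep
    have h3 := T.dep_par t' (by
      rintro rfl
      rw [T.par_root] at ht2'
      exact ht2' ht1')
    omega

end IsWordTree

/-! ### The scale of a subtree -/

/-- The size of the subtree of `c`: the largest ratio of a word whose whole cylinder lies in this
subtree. -/
noncomputable def RTree.scale {A : Type*} {n : ℕ} (T : RTree (List.Vector A n)) (r : A → ℝ)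
    (c : List.Vector A n) : ℝ :=
  sSup {ρ | ∃ u, (cyl n u).Nonempty ∧ (∀ w ∈ cyl n u, T.Anc c w) ∧ ρ = wordRatio r u}

theorem mem_cyl_self {A : Type*} {n : ℕ} (c : List.Vector A n) : c ∈ cyl n c.1 :=
  List.suffix_rfl

theorem eq_of_mem_cyl {A : Type*} {n : ℕ} {c w : List.Vector A n} (hw : w ∈ cyl n c.1) : w = c :=
  Subtype.ext (List.IsSuffix.eq_of_length (mem_cyl.1 hw) (by rw [c.2, w.2])).symm

theorem RTree.exists_of_lt_scale {A : Type*} {n : ℕ} {T : RTree (List.Vector A n)} {r : A → ℝ}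
    {c : List.Vector A n} {δ : ℝ} (hδ : δ < T.scale r c) :
    ∃ u, (cyl n u).Nonempty ∧ (∀ w ∈ cyl n u, T.Anc c w) ∧ δ < wordRatio r u := by
  have hne : {ρ | ∃ u, (cyl n u).Nonempty ∧ (∀ w ∈ cyl n u, T.Anc c w) ∧
      ρ = wordRatio r u}.Nonempty :=
    ⟨_, c.1, ⟨c, mem_cyl_self c⟩,
      fun w hw => by rw [eq_of_mem_cyl hw]; exact RTree.Anc.refl c, rfl⟩
  obtain ⟨_, ⟨u, h1, h2, rfl⟩, h3⟩ := exists_lt_of_lt_csSup hne hδ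
  exact ⟨u, h1, h2, h3⟩

namespace IsSelfSimilar

variable {X : Type*} [MetricSpace X] {A : Type*} [Fintype A] {φ : A → X → X} {r : A → ℝ} {s : ℝ}
  {K : Set X} (h : IsSelfSimilar φ r s K) {n : ℕ} {T : RTree (List.Vector A n)}

include h

theorem cyl_nonempty {u : List A} (hu : u.length ≤ n) : (cyl n u).Nonempty := by
  obtain ⟨x, hx⟩ := h.piece_nonempty u
  obtain ⟨v, hv, -⟩ := h.exists_mem_piece hu hx
  exact ⟨v, hv⟩

theorem le_scale {c : List.Vector A n} {u : List A} (hu : (cyl n u).Nonempty)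
    (hc : ∀ w ∈ cyl n u, T.Anc c w) : wordRatio r u ≤ T.scale r c := by
  refine le_csSup ⟨1, ?_⟩ ⟨u, hu, hc, rfl⟩
  rintro _ ⟨u, -, -, rfl⟩
  have := h.wordRatio_le_of_suffix (List.nil_suffix (l := u))
  rwa [wordRatio_nil] at this

theorem scale_pos (c : List.Vector A n) : 0 < T.scale r c :=
  (h.wordRatio_pos c.1).trans_le (h.le_scale ⟨c, mem_cyl_self c⟩ fun w hw => by
    rw [eq_of_mem_cyl hw]; exact RTree.Anc.refl c)

/-- A subtree of scale above `δ` carries a mass of at least `δ ^ s`. -/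
theorem rpow_le_mass {c : List.Vector A n} {δ : ℝ} (hδ0 : 0 ≤ δ) (hδ : δ < T.scale r c) :
    δ ^ s ≤ T.mass (fun v => wordRatio r v.1 ^ s) c := by
  classical
  obtain ⟨u, ⟨v, hv⟩, hu, hlt⟩ := RTree.exists_of_lt_scale hδ
  calc δ ^ s ≤ wordRatio r u ^ s := Real.rpow_le_rpow hδ0 hlt.le h.s_pos.le
    _ = ∑ v with v ∈ cyl n u, wordRatio r v.1 ^ s := (h.sum_cyl (length_le_of_mem_cyl hv)).symm
    _ ≤ _ := Finset.sum_le_sum_of_subset_of_nonneg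
        (fun w hw => RTree.mem_desc.2 (hu w (Finset.mem_filter.1 hw).2))
        fun w _ _ => Real.rpow_nonneg (h.wordRatio_pos w.1).le s

variable (hT : IsWordTree φ K n T)

include hT

/-- A subtree that leaves the cylinder of size `δ` around a vertex contains a whole neighbouring
cylinder of this size. -/
theorem exists_cut_anc {δ : ℝ} (hδ : ∀ v : List.Vector A n, wordRatio r v.1 ≤ δ)
    {q x : List.Vector A n} (hqx : T.Anc q x) (hx : x ∉ cyl n (cut r δ q.1)) :
    ∃ y, T.Anc y x ∧ T.dep q < T.dep y ∧ T.par y ∈ cyl n (cut r δ q.1) ∧ cut r δ y.1 ≠ [] ∧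
      ∀ w ∈ cyl n (cut r δ y.1), T.Anc y w := by
  obtain ⟨y, hy1, hy2, hy3, hy4⟩ := hqx.exists_exit (S := cyl n (cut r δ q.1))
    (cut_suffix r δ q.1) hx
  have hpar : T.par y ∉ cyl n (cut r δ y.1) := by
    intro hmem
    have h1 := cut_eq_of_suffix h (hδ y) (mem_cyl.1 hmem)
    have h2 := cut_eq_of_suffix h (hδ q) (mem_cyl.1 hy2)
    refine hy1 (mem_cyl.2 ?_)
    rw [← h2, h1]
    exact cut_suffix r δ y.1
  refine ⟨y, hy4, ?_, hy2, ?_, hT.anc_of_par_notMem _ y (cut_suffix r δ y.1) hpar⟩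
  · have h1 := hy3.dep_le
    have h2 := T.dep_par y (by
      rintro rfl
      rw [T.par_root] at hy2
      exact hy1 hy2)
    omega
  · intro h0
    rw [h0] at hpar
    exact hpar List.nil_suffix

/-- If the subtree of `c` is not contained in the cylinder of size `δ` around `c`, then its scale is
not much smaller than `δ`. -/
theorem lt_scale_of_notMem {ρ δ : ℝ} (hρ0 : 0 < ρ) (hρ : ∀ i, ρ ≤ r i) (hδ0 : 0 < δ)
    (hδ : ∀ v : List.Vector A n, wordRatio r v.1 ≤ δ) {c x : List.Vector A n} (hcx : T.Anc c x)
    (hx : x ∉ cyl n (cut r δ c.1)) : ρ * δ < T.scale r c := by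
  obtain ⟨y, hyx, hdep, -, hne, htop⟩ := h.exists_cut_anc hT hδ hcx hx
  refine (lt_wordRatio_cut hδ0 hρ0 hρ hne).trans_le (h.le_scale ⟨y, cut_suffix r δ y.1⟩ ?_)
  exact fun w hw => (hcx.anc_of_dep_le hyx hdep.le).trans (htop w hw)

/-- The subtree of a child `c` of `p`, if of scale above `δ`, contains a whole cylinder of size about
`δ` next to the one around `p`. -/
theorem exists_near_of_lt_scale {δ : ℝ} (hδ : ∀ v : List.Vector A n, wordRatio r v.1 ≤ δ)
    {p c : List.Vector A n} (hc : T.IsChild c p) (hsc : δ < T.scale r c) :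
    ∃ y, T.Anc c y ∧ T.par y ∈ cyl n (cut r δ p.1) ∧ cut r δ y.1 ≠ [] ∧
      ∀ w ∈ cyl n (cut r δ y.1), T.Anc c w := by
  obtain ⟨u, ⟨x, hxu⟩, hu, hlt⟩ := RTree.exists_of_lt_scale hsc
  have hx : x ∉ cyl n (cut r δ p.1) := by
    intro hmem
    have h1 := cut_eq_of_suffix h (hδ p) (mem_cyl.1 hmem)
    have h2 := suffix_cut h (mem_cyl.1 hxu) hlt
    rw [h1] at h2
    exact hc.not_anc (hu p (h2.trans (cut_suffix r δ p.1)))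
  obtain ⟨y, hyx, hdep, hpar, hne, htop⟩ := h.exists_cut_anc hT hδ (hc.anc.trans (hu x hxu)) hx
  have hcy : T.Anc c y := (hu x hxu).anc_of_dep_le hyx (by rw [hc.dep]; exact hdep)
  exact ⟨y, hcy, hpar, hne, fun w hw => hcy.trans (htop w hw)⟩

/-- Only boundedly many branches of scale comparable to `D` hang off a path in a ball of radius
comparable to `D`, because they contain disjoint cylinders of this size near the ball. -/
theorem card_le_of_scale {ρ κ Δ : ℝ} (hρ0 : 0 < ρ) (hρ : ∀ i, ρ ≤ r i) (hρ1 : ρ ≤ 1)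
    (hκ0 : 0 < κ) (hκ : ∀ (n : ℕ) (S : Finset (List.Vector A n)) (D : ℝ), 0 ≤ D →
      (∀ v ∈ S, ∀ w ∈ S, ∀ x ∈ piece φ K v.1, ∀ y ∈ piece φ K w.1, dist x y ≤ D) →
      κ * ∑ v ∈ S, wordRatio r v.1 ^ s ≤ D ^ s)
    (hΔ0 : 0 < Δ) (hΔ : ∀ w : List A, ∀ x ∈ piece φ K w, ∀ y ∈ piece φ K w,
      dist x y ≤ wordRatio r w * Δ)
    {x : List.Vector A n → X} (hx : ∀ v, x v ∈ piece φ K v.1)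
    {D : ℝ} (hD : 0 < D) {δ : ℝ} (hδD : 8 * Δ * δ = ρ * D)
    (hδ : ∀ v : List.Vector A n, wordRatio r v.1 ≤ δ) {z y : List.Vector A n}
    (hball : ∀ p, T.Anc z p → T.Anc p y → dist (x z) (x p) ≤ 2 * D)
    (B : Finset (List.Vector A n))
    (hB : ∀ p ∈ B, T.Anc p y ∧ T.Anc z p ∧
      ∃ c, T.IsChild c p ∧ ¬ T.Anc c y ∧ δ < T.scale r c) :
    (B.card : ℝ) ≤ (48 * Δ / ρ ^ 2) ^ s / κ := by
  classical
  have hδ0 : 0 < δ := by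
    have : 0 < 8 * Δ * δ := hδD ▸ mul_pos hρ0 hD
    exact pos_of_mul_pos_right this (by positivity)
  have hδΔ : δ * Δ ≤ D / 8 := by nlinarith
  have hnear : ∀ p ∈ B, ∃ c e, T.IsChild c p ∧ ¬ T.Anc c y ∧ T.par e ∈ cyl n (cut r δ p.1) ∧
      cut r δ e.1 ≠ [] ∧ ∀ w ∈ cyl n (cut r δ e.1), T.Anc c w := by
    intro p hp
    obtain ⟨-, -, c, hc, hcy, hsc⟩ := hB p hp
    obtain ⟨e, -, h2, h3, h4⟩ := h.exists_near_of_lt_scale hT hδ hc hsc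
    exact ⟨c, e, hc, hcy, h2, h3, h4⟩
  have : Nonempty (List.Vector A n) := ⟨z⟩
  choose! c e hc hcy hpar hne htop using hnear
  let S : Finset (List.Vector A n) :=
    B.biUnion fun p => Finset.univ.filter fun v => v ∈ cyl n (cut r δ (e p).1)
  have hsum : ∑ v ∈ S, wordRatio r v.1 ^ s = ∑ p ∈ B, wordRatio r (cut r δ (e p).1) ^ s := by
    rw [Finset.sum_biUnion]
    · refine Finset.sum_congr rfl fun p _ => h.sum_cyl ?_
      exact length_le_of_mem_cyl (mem_cyl.2 (cut_suffix r δ (e p).1))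
    · intro p hp p' hp' hpp'
      refine Finset.disjoint_left.2 fun v hv hv' => hpp' ?_
      exact RTree.eq_of_anc_of_not_anc (hB p hp).1 (hB p' hp').1 (hc p hp) (hc p' hp') (hcy p hp)
        (hcy p' hp') (htop p hp v (Finset.mem_filter.1 hv).2)
        (htop p' hp' v (Finset.mem_filter.1 hv').2)
  have hlow : (B.card : ℝ) * (ρ * δ) ^ s ≤ ∑ v ∈ S, wordRatio r v.1 ^ s := by
    rw [hsum, ← nsmul_eq_mul]
    refine Finset.card_nsmul_le_sum _ _ _ fun p hp => ?_
    exact Real.rpow_le_rpow (by positivity) (lt_wordRatio_cut hδ0 hρ0 hρ (hne p hp)).le h.s_pos.le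
  -- all the pieces lie in a ball of radius `3 * D`
  have hcut : ∀ p v w : List.Vector A n, v ∈ cyl n (cut r δ p.1) → w ∈ cyl n (cut r δ p.1) →
      ∀ a ∈ piece φ K v.1, ∀ b ∈ piece φ K w.1, dist a b ≤ D / 8 := by
    intro p v w hv hw a ha b hb
    refine (hΔ (cut r δ p.1) a (h.piece_subset_of_suffix hv ha) b
      (h.piece_subset_of_suffix hw hb)).trans (le_trans ?_ hδΔ)
    exact mul_le_mul_of_nonneg_right (wordRatio_cut_le (hδ p)) hΔ0.le
  have hrad : ∀ v ∈ S, ∀ a ∈ piece φ K v.1, dist (x z) a ≤ 3 * D := by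
    intro v hv a ha
    obtain ⟨p, hp, hv⟩ := Finset.mem_biUnion.1 hv
    have h1 := hcut (e p) (e p) v (cut_suffix r δ _) (Finset.mem_filter.1 hv).2 (x (e p)) (hx _) a ha
    obtain ⟨b, hb1, hb2⟩ := hT.adj (e p)
    have h2 := hcut (e p) (e p) (e p) (cut_suffix r δ _) (cut_suffix r δ _) b hb1 (x (e p)) (hx _)
    have h3 := hcut p p (T.par (e p)) (cut_suffix r δ _) (hpar p hp) (x p) (hx p) b hb2
    have h4 := hball p (hB p hp).2.1 (hB p hp).1
    have h5 := dist_triangle4 (x z) (x p) b (x (e p))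
    have h6 := dist_triangle (x z) (x (e p)) a
    linarith
  have hup := hκ n S (6 * D) (by positivity) (by
    intro v hv w hw a ha b hb
    have h1 := hrad v hv a ha
    have h2 := hrad w hw b hb
    have h3 := dist_triangle_left a b (x z)
    linarith)
  have hfin : (B.card : ℝ) * κ * (ρ * δ) ^ s ≤ (48 * Δ / ρ ^ 2) ^ s * (ρ * δ) ^ s := by
    rw [← Real.mul_rpow (by positivity) (by positivity)]
    -- the diameter of the ball, in terms of the size of the cylinders
    have : 48 * Δ / ρ ^ 2 * (ρ * δ) = 6 * D := by
      field_simp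
      linarith
    rw [this]
    calc (B.card : ℝ) * κ * (ρ * δ) ^ s = κ * ((B.card : ℝ) * (ρ * δ) ^ s) := by ring
      _ ≤ κ * ∑ v ∈ S, wordRatio r v.1 ^ s := mul_le_mul_of_nonneg_left hlow hκ0.le
      _ ≤ _ := hup
  rw [le_div_iff₀ hκ0]
  exact le_of_mul_le_mul_right hfin (Real.rpow_pos_of_pos (by positivity) s)

end IsSelfSimilar

/-! ### Large branches on both sides of a path -/

namespace IsSelfSimilar

variable {X : Type*} [MetricSpace X] {A : Type*} [Fintype A] {φ : A → X → X} {r : A → ℝ} {s : ℝ}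
  {K : Set X} {n : ℕ} {T : RTree (List.Vector A n)}

/-- A path of diameter comparable to `D` has branches of scale comparable to `D` on both sides.

The path crosses `J` disjoint cylinders of size about `D / J`, and has a branch of at least this
scale in each of them. All but `N` of these branches are of scale at most a small multiple of `D`,
so that there are only about `log J` labels for them, and where only such branches hang off, the
path descends to the child of the largest scale. Hence two of the branches have the same label and
no large branch in between. -/
theorem exists_branches (h : IsSelfSimilar φ r s K) (hT : IsWordTree φ K n T) {ρ κ Δ : ℝ}
    (hρ0 : 0 < ρ) (hρ : ∀ i, ρ ≤ r i) (hρ1 : ρ ≤ 1)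
    (hκ0 : 0 < κ) (hκ : ∀ (n : ℕ) (S : Finset (List.Vector A n)) (D : ℝ), 0 ≤ D →
      (∀ v ∈ S, ∀ w ∈ S, ∀ x ∈ piece φ K v.1, ∀ y ∈ piece φ K w.1, dist x y ≤ D) →
      κ * ∑ v ∈ S, wordRatio r v.1 ^ s ≤ D ^ s)
    (hΔ0 : 0 < Δ) (hΔ : ∀ w : List A, ∀ x ∈ piece φ K w, ∀ y ∈ piece φ K w,
      dist x y ≤ wordRatio r w * Δ)
    {N J G : ℕ} (hN : (48 * Δ / ρ ^ 2) ^ s / κ ≤ N) (hJ : N + (N + 1) * (G + 1) < J)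
    (hG : (J : ℝ) + 1 ≤ ρ * 2 ^ G)
    {x : List.Vector A n → X} (hx : ∀ v, x v ∈ piece φ K v.1) {rk : List.Vector A n → ℕ}
    (hrk : ∀ (g : ℤ) (p c p' c' : List.Vector A n), T.IsChild c p → T.Anc c p' → T.IsChild c' p' →
        (∀ q d, T.Anc p q → T.IsChild d q → T.Anc d c' →
          ∀ d', T.IsChild d' q → d' ≠ d → T.scale r d' < T.scale r d) →
        (∃ d, T.IsChild d p ∧ d ≠ c ∧ Int.log 2 (T.scale r d) = g ∧
          ∀ d', T.IsChild d' p → d' ≠ c → T.scale r d' ≤ T.scale r d) →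
        (∃ d, T.IsChild d p' ∧ d ≠ c' ∧ Int.log 2 (T.scale r d) = g ∧
          ∀ d', T.IsChild d' p' → d' ≠ c' → T.scale r d' ≤ T.scale r d) →
        (∃ q d e, T.Anc p q ∧ T.IsChild d q ∧ T.Anc d c' ∧ T.IsChild e q ∧ rk e < rk d ∧
          Int.log 2 (T.scale r e) = g) ∧
        (∃ q d e, T.Anc p q ∧ T.IsChild d q ∧ T.Anc d c' ∧ T.IsChild e q ∧ rk d < rk e ∧
          Int.log 2 (T.scale r e) = g))
    {z y : List.Vector A n} {D : ℝ} (hD : 0 < D)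
    (hε : ∀ v : List.Vector A n, 16 * (J + 1) * Δ * wordRatio r v.1 ≤ ρ * D)
    (hzy : T.Anc z y) (hball : ∀ p, T.Anc z p → T.Anc p y → dist (x z) (x p) ≤ 2 * D)
    (hfar : D ≤ dist (x z) (x y)) :
    (∃ q d e, T.Anc z q ∧ T.IsChild d q ∧ T.Anc d y ∧ T.IsChild e q ∧ rk e < rk d ∧
      ρ ^ 2 * D / (16 * (J + 1) * Δ) < T.scale r e) ∧
    (∃ q d e, T.Anc z q ∧ T.IsChild d q ∧ T.Anc d y ∧ T.IsChild e q ∧ rk d < rk e ∧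
      ρ ^ 2 * D / (16 * (J + 1) * Δ) < T.scale r e) := by
  classical
  have hJ0 : (0 : ℝ) ≤ J := Nat.cast_nonneg J
  obtain ⟨η, hη⟩ : ∃ η : ℝ, 2 * (J + 1) * η = D := ⟨D / (2 * (J + 1)), by field_simp⟩
  have hη0 : 0 < η := pos_of_mul_pos_right (hη ▸ hD) (by positivity)
  obtain ⟨δ, hδ⟩ : ∃ δ : ℝ, 4 * Δ * δ = η := ⟨η / (4 * Δ), by field_simp⟩
  have hδ0 : 0 < δ := pos_of_mul_pos_right (hδ ▸ hη0) (by positivity)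
  obtain ⟨δ', hδ'⟩ : ∃ δ' : ℝ, 8 * Δ * δ' = D := ⟨D / (8 * Δ), by field_simp⟩
  have hδ'0 : 0 < δ' := pos_of_mul_pos_right (hδ' ▸ hD) (by positivity)
  have hδδ' : δ' = (J + 1) * δ := by
    have : 8 * Δ * δ' = 8 * Δ * ((J + 1) * δ) := by
      rw [hδ', ← hη, ← hδ]; ring
    exact mul_left_cancel₀ (by positivity) this
  have hsmall : ∀ v : List.Vector A n, 2 * wordRatio r v.1 ≤ ρ * δ := by
    intro v
    have h1 := hε v
    rw [← hη, ← hδ] at h1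
    have h2 : (8 * (J + 1) * Δ) * (2 * wordRatio r v.1) ≤ (8 * (J + 1) * Δ) * (ρ * δ) := by
      linarith
    exact le_of_mul_le_mul_left h2 (by positivity)
  have hρδ : ρ * δ ≤ δ := mul_le_of_le_one_left hδ0.le hρ1
  have hδδ'le : δ ≤ δ' := by rw [hδδ']; nlinarith
  have hsmall1 : ∀ v : List.Vector A n, wordRatio r v.1 ≤ δ := fun v => by
    have := hsmall v; have := h.wordRatio_pos v.1; linarith
  have hsmall2 : ∀ v : List.Vector A n, wordRatio r v.1 ≤ ρ * δ' := fun v => by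
    have := hsmall v
    have := h.wordRatio_pos v.1
    have := mul_le_mul_of_nonneg_left hδδ'le hρ0.le
    linarith
  have hsmall3 : ∀ v : List.Vector A n, wordRatio r v.1 ≤ δ' := fun v =>
    (hsmall1 v).trans hδδ'le
  have hstep : ∀ v, dist (x v) (x (T.par v)) ≤ η / 4 := by
    intro v
    obtain ⟨b, hb1, hb2⟩ := hT.adj v
    have h1 := hΔ v.1 (x v) (hx v) b hb1
    have h2 := hΔ (T.par v).1 b hb2 (x (T.par v)) (hx _)
    have h3 := mul_le_mul_of_nonneg_right (hsmall v) hΔ0.le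
    have h4 := mul_le_mul_of_nonneg_right (hsmall (T.par v)) hΔ0.le
    have h5 := mul_le_mul_of_nonneg_right hρδ hΔ0.le
    have h6 := dist_triangle (x v) b (x (T.par v))
    linarith
  have hcyl : ∀ (δ : ℝ), (∀ v : List.Vector A n, wordRatio r v.1 ≤ δ) →
      ∀ p v w : List.Vector A n, v ∈ cyl n (cut r δ p.1) → w ∈ cyl n (cut r δ p.1) →
      dist (x v) (x w) ≤ δ * Δ := by
    intro δ hδ p v w hv hw
    exact (hΔ (cut r δ p.1) _ (h.piece_subset_of_suffix hv (hx v)) _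
      (h.piece_subset_of_suffix hw (hx w))).trans
      (mul_le_mul_of_nonneg_right (wordRatio_cut_le (hδ p)) hΔ0.le)
  -- points at equally spaced distances from the beginning of the path
  have hτ : ∀ j : Fin J, ((j : ℕ) + 1 : ℝ) * η ≤ D / 2 - η := by
    intro j
    have h1 : ((j : ℕ) + 1 : ℝ) ≤ J := by exact_mod_cast j.2
    have h2 := mul_le_mul_of_nonneg_right h1 hη0.le
    linarith
  have hq : ∀ j : Fin J, ∃ q, T.Anc z q ∧ T.Anc q y ∧ ((j : ℕ) + 1 : ℝ) * η ≤ dist (x z) (x q) ∧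
      dist (x z) (x q) ≤ ((j : ℕ) + 1 : ℝ) * η + η / 4 := by
    intro j
    have hpos : 0 < ((j : ℕ) + 1 : ℝ) * η := by positivity
    obtain ⟨q, h1, h2, h3, h4⟩ := hzy.exists_exit
      (S := {v | dist (x z) (x v) < ((j : ℕ) + 1 : ℝ) * η}) (by simpa using hpos)
      (by simp only [Set.mem_ofPred_eq, not_lt]; linarith [hτ j])
    simp only [Set.mem_ofPred_eq, not_lt] at h1 h2
    refine ⟨q, h3.trans (RTree.anc_par q), h4, h1, ?_⟩
    have h5 := dist_triangle_right (x z) (x q) (x (T.par q))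
    have h6 := hstep q
    linarith
  choose q hzq hqy hqlow hqup using hq
  -- the branches near these points
  have hp : ∀ j : Fin J, ∃ p, T.Anc z p ∧ T.Anc p y ∧ dist (x p) (x (q j)) ≤ η / 4 ∧
      ∃ c, T.IsChild c p ∧ ¬ T.Anc c y ∧ ρ ^ 2 * δ < T.scale r c := by
    intro j
    have hpos : 0 ≤ ((j : ℕ) : ℝ) * η := by positivity
    have hz : z ∉ cyl n (cut r δ (q j).1) := by
      intro hz
      have h1 := hcyl δ hsmall1 (q j) z (q j) hz (cut_suffix r δ _)
      have := hqlow j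
      linarith
    have hne : cut r δ (q j).1 ≠ [] := by
      intro h0
      rw [h0] at hz
      exact hz List.nil_suffix
    have hrat := lt_wordRatio_cut hδ0 hρ0 hρ hne
    have hlen : (cut r δ (q j).1).length < n := by
      refine lt_of_le_of_ne (length_le_of_mem_cyl (mem_cyl.2 (cut_suffix r δ (q j).1))) fun h0 => ?_
      have h1 : cut r δ (q j).1 = (q j).1 :=
        (cut_suffix r δ (q j).1).eq_of_length (by rw [h0, (q j).2])
      rw [h1] at hrat
      have := hsmall (q j)
      have := h.wordRatio_pos (q j).1
      linarith
    obtain ⟨p, hzp, hpy, hpu, c, i, hc, hcy, hci⟩ := hT.exists_branch hlen (hzq j) (hqy j) hz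
      (cut_suffix r δ _) fun i => h.cyl_nonempty (by simpa using hlen)
    refine ⟨p, hzp, hpy, ?_, c, hc, hcy, ?_⟩
    · have := hcyl δ hsmall1 (q j) p (q j) hpu (cut_suffix r δ _)
      linarith
    · have h1 := h.le_scale (h.cyl_nonempty (n := n) (u := i :: cut r δ (q j).1)
        (by simpa using hlen)) hci
      rw [wordRatio_cons] at h1
      have h2 := mul_lt_mul_of_pos_left hrat hρ0
      have h3 := mul_le_mul_of_nonneg_right (hρ i) (h.wordRatio_pos (cut r δ (q j).1)).le
      calc ρ ^ 2 * δ = ρ * (ρ * δ) := by ring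
        _ < _ := h2
        _ ≤ _ := h3
        _ ≤ _ := h1
  choose p hzp hpy hpq hpc using hp
  have hplow : ∀ j : Fin J, ((j : ℕ) + 1 : ℝ) * η - η / 4 ≤ dist (x z) (x (p j)) := by
    intro j
    have := dist_triangle (x z) (x (p j)) (x (q j))
    linarith [hqlow j, hpq j]
  have hpup : ∀ j : Fin J, dist (x z) (x (p j)) ≤ ((j : ℕ) + 1 : ℝ) * η + η / 2 := by
    intro j
    have := dist_triangle_right (x z) (x (p j)) (x (q j))
    linarith [hqup j, hpq j]
  have hpinj : Function.Injective p := by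
    have key : ∀ j k : Fin J, (j : ℕ) < k → p j ≠ p k := by
      intro j k hjk hp
      have h1 := hpup j
      have h2 := hplow k
      rw [hp] at h1
      have h3 : ((j : ℕ) : ℝ) + 1 ≤ (k : ℕ) := by exact_mod_cast hjk
      have h4 := mul_le_mul_of_nonneg_right h3 hη0.le
      linarith
    intro j k hjk
    rcases lt_trichotomy (j : ℕ) k with h1 | h1 | h1
    · exact absurd hjk (key j k h1)
    · exact Fin.ext h1
    · exact absurd hjk.symm (key k j h1)
  have hd : ∀ j : Fin J, ∃ d, T.IsChild d (p j) ∧ ¬ T.Anc d y ∧ ρ ^ 2 * δ < T.scale r d ∧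
      ∀ d', T.IsChild d' (p j) → ¬ T.Anc d' y → T.scale r d' ≤ T.scale r d := by
    intro j
    obtain ⟨c, hc, hcy, hcs⟩ := hpc j
    obtain ⟨d, hd, hmax⟩ := Finset.exists_max_image
      ((T.children (p j)).filter fun d => ¬ T.Anc d y) (T.scale r)
      ⟨c, by simp [hc, hcy]⟩
    simp only [Finset.mem_filter, RTree.mem_children] at hd hmax
    exact ⟨d, hd.1, hd.2, hcs.trans_le (hmax c ⟨hc, hcy⟩), fun d' h1 h2 => hmax d' ⟨h1, h2⟩⟩
  choose d hdp hdy hds hdmax using hd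
  -- the vertices of the path with a large branch
  let B : Finset (List.Vector A n) := Finset.univ.filter fun b => T.Anc b y ∧ T.Anc z b ∧
    ∃ c, T.IsChild c b ∧ ¬ T.Anc c y ∧ ρ * δ' < T.scale r c
  have hBcard : B.card ≤ N := by
    have h1 := h.card_le_of_scale hT hρ0 hρ hρ1 hκ0 hκ hΔ0 hΔ hx hD (δ := ρ * δ')
      (by rw [← hδ']; ring) hsmall2 hball B (fun b hb => (Finset.mem_filter.1 hb).2)
    exact_mod_cast h1.trans hN
  let good : Finset (Fin J) := Finset.univ.filter fun j => p j ∉ B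
  have hgood : (N + 1) * (G + 1) < good.card := by
    have h1 : (Finset.univ.filter fun j : Fin J => p j ∈ B).card ≤ B.card :=
      Finset.card_le_card_of_injOn p (fun j hj => (Finset.mem_filter.1 hj).2) hpinj.injOn
    have h2 := Finset.card_filter_add_card_filter_not (s := (Finset.univ : Finset (Fin J)))
      (fun j => p j ∈ B)
    rw [Finset.card_univ, Fintype.card_fin] at h2
    have h3 : good.card = (Finset.univ.filter fun j : Fin J => ¬ p j ∈ B).card := rfl
    omega
  have hmaps : ∀ j ∈ good, ((B.filter fun b => T.Anc b (p j)).card, Int.log 2 (T.scale r (d j))) ∈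
      Finset.range (N + 1) ×ˢ
        Finset.Icc (Int.log 2 (ρ ^ 2 * δ)) (Int.log 2 (ρ ^ 2 * δ) + G) := by
    intro j hj
    have hlow := hds j
    have hup : T.scale r (d j) ≤ ρ * δ' := by
      by_contra! hlt
      exact (Finset.mem_filter.1 hj).2 (Finset.mem_filter.2
        ⟨Finset.mem_univ _, hpy j, hzp j, d j, hdp j, hdy j, hlt⟩)
    have hpos : 0 < ρ ^ 2 * δ := by positivity
    rw [Finset.mem_product, Finset.mem_range, Finset.mem_Icc]
    refine ⟨Nat.lt_succ_of_le ((Finset.card_filter_le _ _).trans hBcard),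
      Int.log_mono_right hpos hlow.le, ?_⟩
    have h1 : T.scale r (d j) < (2 : ℝ) ^ (Int.log 2 (ρ ^ 2 * δ) + G + 1) := by
      have h2 := Int.lt_zpow_succ_log_self (b := 2) one_lt_two (ρ ^ 2 * δ)
      calc T.scale r (d j) ≤ ρ * δ' := hup
        _ = ((J : ℝ) + 1) * (ρ * δ) := by rw [hδδ']; ring
        _ ≤ (ρ * 2 ^ G) * (ρ * δ) := mul_le_mul_of_nonneg_right hG (by positivity)
        _ = (ρ ^ 2 * δ) * 2 ^ G := by ring
        _ < (2 : ℝ) ^ (Int.log 2 (ρ ^ 2 * δ) + 1) * 2 ^ G :=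
            mul_lt_mul_of_pos_right (by exact_mod_cast h2) (by positivity)
        _ = _ := by
            rw [← zpow_natCast (2 : ℝ) G, ← zpow_add₀ (by norm_num)]
            congr 1; ring
    have h3 := Int.zpow_log_le_self (b := 2) one_lt_two (h.scale_pos (T := T) (d j))
    have h4 : (2 : ℝ) ^ Int.log 2 (T.scale r (d j)) < 2 ^ (Int.log 2 (ρ ^ 2 * δ) + G + 1) :=
      lt_of_le_of_lt (by exact_mod_cast h3) h1
    have h5 := (zpow_lt_zpow_iff_right₀ (by norm_num : (1 : ℝ) < 2)).1 h4
    omega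
  obtain ⟨j, hj, k, hk, hjk, hF⟩ := Finset.exists_ne_map_eq_of_card_lt_of_maps_to
    (by rw [Finset.card_product, Finset.card_range, Int.card_Icc]
        have : (Int.log 2 (ρ ^ 2 * δ) + G + 1 - Int.log 2 (ρ ^ 2 * δ)).toNat = G + 1 := by omega
        rw [this]; exact hgood) hmaps
  have key : ∀ j k : Fin J, j ≠ k → p k ∉ B → p j ∉ B → T.Anc (p j) (p k) →
      (B.filter fun b => T.Anc b (p j)).card = (B.filter fun b => T.Anc b (p k)).card →
      Int.log 2 (T.scale r (d j)) = Int.log 2 (T.scale r (d k)) →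
      (∃ q d e, T.Anc z q ∧ T.IsChild d q ∧ T.Anc d y ∧ T.IsChild e q ∧ rk e < rk d ∧
        ρ ^ 2 * D / (16 * (J + 1) * Δ) < T.scale r e) ∧
      (∃ q d e, T.Anc z q ∧ T.IsChild d q ∧ T.Anc d y ∧ T.IsChild e q ∧ rk d < rk e ∧
        ρ ^ 2 * D / (16 * (J + 1) * Δ) < T.scale r e) := by
    intro j k hjk hkB hjB hanc hcard hlog
    have hsub : (B.filter fun b => T.Anc b (p j)) = B.filter fun b => T.Anc b (p k) :=
      Finset.eq_of_subset_of_card_le (fun b hb => by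
        rw [Finset.mem_filter] at hb ⊢
        exact ⟨hb.1, hb.2.trans hanc⟩) hcard.ge
    have hpky : p k ≠ y := by
      intro hpk
      have h1 := hpup k
      rw [hpk] at h1
      linarith [hτ k]
    obtain ⟨c, hc, hcp⟩ := hanc.exists_child (fun h1 => hjk (hpinj h1))
    obtain ⟨c', hc', hcy'⟩ := (hpy k).exists_child hpky
    have hcy : T.Anc c y := hcp.trans (hpy k)
    have hne : ∀ (q a b : List.Vector A n), T.IsChild a q → T.IsChild b q → T.Anc b y →
        (a ≠ b ↔ ¬ T.Anc a y) := by
      intro q a b ha hb hby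
      refine ⟨fun hab hay => hab (ha.eq_of_anc hb hay hby), ?_⟩
      rintro hay rfl
      exact hay hby
    have hres := hrk (Int.log 2 (T.scale r (d j))) (p j) c (p k) c' hc hcp hc' ?_
      ⟨d j, hdp j, (hne _ _ _ (hdp j) hc hcy).2 (hdy j), rfl, fun d' h1 h2 =>
        hdmax j d' h1 ((hne _ _ _ h1 hc hcy).1 h2)⟩
      ⟨d k, hdp k, (hne _ _ _ (hdp k) hc' hcy').2 (hdy k), hlog.symm, fun d' h1 h2 =>
        hdmax k d' h1 ((hne _ _ _ h1 hc' hcy').1 h2)⟩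
    · have hbig : ∀ e, Int.log 2 (T.scale r e) = Int.log 2 (T.scale r (d j)) →
          ρ ^ 2 * D / (16 * (J + 1) * Δ) < T.scale r e := by
        intro e he
        have h1 := Int.zpow_log_le_self (b := 2) one_lt_two (h.scale_pos (T := T) e)
        have h2 := Int.lt_zpow_succ_log_self (b := 2) one_lt_two (T.scale r (d j))
        rw [he] at h1
        rw [zpow_add₀ (by norm_num), zpow_one] at h2
        have h3 : ρ ^ 2 * D / (16 * (J + 1) * Δ) = ρ ^ 2 * δ / 2 := by
          rw [← hη, ← hδ]; field_simp; ring
        rw [h3]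
        have h4 := hds j
        push_cast at h1 h2
        linarith
      obtain ⟨⟨q₁, d₁, e₁, a1, a2, a3, a4, a5, a6⟩, ⟨q₂, d₂, e₂, b1, b2, b3, b4, b5, b6⟩⟩ := hres
      exact ⟨⟨q₁, d₁, e₁, (hzp j).trans a1, a2, a3.trans hcy', a4, a5, hbig e₁ a6⟩,
        ⟨q₂, d₂, e₂, (hzp j).trans b1, b2, b3.trans hcy', b4, b5, hbig e₂ b6⟩⟩
    · intro q a hpq ha hac d' hd' hd'a
      have hay : T.Anc a y := hac.trans hcy'
      have hqk : T.Anc q (p k) := by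
        have h1 : q ≠ c' := by rintro rfl; exact ha.not_anc hac
        have h2 := ((ha.anc.trans hac).anc_par h1).2
        rwa [hc'.2] at h2
      have hqB : q ∉ B := by
        intro hqB
        have h1 : q ∈ B.filter fun b => T.Anc b (p k) := Finset.mem_filter.2 ⟨hqB, hqk⟩
        rw [← hsub, Finset.mem_filter] at h1
        exact hjB (hpq.antisymm h1.2 ▸ hqB)
      have hle : T.scale r d' ≤ ρ * δ' := by
        by_contra! hlt
        exact hqB (Finset.mem_filter.2 ⟨Finset.mem_univ _, hqk.trans (hpy k), (hzp j).trans hpq,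
          d', hd', (hne _ _ _ hd' ha hay).1 hd'a, hlt⟩)
      refine hle.trans_lt ?_
      -- the subtree of `a` contains the distant vertices `c'` and `y`
      have hdist : δ' * Δ < dist (x c') (x y) := by
        have h1 := hpup k
        have h2 := hstep c'
        rw [hc'.2] at h2
        have h3 := dist_triangle4 (x z) (x (p k)) (x c') (x y)
        rw [dist_comm (x (p k))] at h3
        have h4 := hτ k
        linarith
      by_cases hcc : c' ∈ cyl n (cut r δ' a.1)
      · refine h.lt_scale_of_notMem hT hρ0 hρ hδ'0 hsmall3 hay fun hy => ?_
        exact absurd (hcyl δ' hsmall3 a c' y hcc hy) (not_le.2 hdist)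
      · exact h.lt_scale_of_notMem hT hρ0 hρ hδ'0 hsmall3 hac hcc
  have hF1 := congrArg Prod.fst hF
  have hF2 := congrArg Prod.snd hF
  simp only at hF1 hF2
  have hjB := (Finset.mem_filter.1 hj).2
  have hkB := (Finset.mem_filter.1 hk).2
  rcases RTree.Anc.total (hpy j) (hpy k) with h1 | h1
  · exact key j k hjk hkB hjB h1 hF1 hF2
  · exact key k j hjk.symm hjB hkB h1 hF1.symm hF2.symm

end IsSelfSimilar

/-! ### Self-similar sets with a branching -/

namespace IsSelfSimilar

variable {X : Type*} [MetricSpace X] {A : Type*} [Fintype A] {φ : A → X → X} {r : A → ℝ} {s : ℝ}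
  {K : Set X}

theorem exists_ratio_bounds (h : IsSelfSimilar φ r s K) :
    ∃ ρ R : ℝ, 0 < ρ ∧ ρ ≤ 1 ∧ 0 ≤ R ∧ R < 1 ∧ ∀ i, ρ ≤ r i ∧ r i ≤ R := by
  have hne : Nonempty A := by
    obtain ⟨x, hx⟩ := h.isConnected.nonempty
    rw [h.eq_iUnion, Set.mem_iUnion] at hx
    exact ⟨hx.choose⟩
  obtain ⟨i, -, hi⟩ := Finset.univ.exists_min_image r Finset.univ_nonempty
  obtain ⟨j, -, hj⟩ := Finset.univ.exists_max_image r Finset.univ_nonempty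
  exact ⟨r i, r j, h.r_pos i, (h.r_lt_one i).le, (h.r_pos j).le, h.r_lt_one j, fun k =>
    ⟨hi k (Finset.mem_univ k), hj k (Finset.mem_univ k)⟩⟩

theorem exists_forall_wordRatio_le (h : IsSelfSimilar φ r s K) {ε : ℝ} (hε : 0 < ε) :
    ∃ n, ∀ v : List.Vector A n, wordRatio r v.1 ≤ ε := by
  obtain ⟨_, R, -, -, hR0, hR1, hR⟩ := h.exists_ratio_bounds
  obtain ⟨n, hn⟩ := exists_pow_lt_of_lt_one hε hR1
  refine ⟨n, fun v => le_trans ?_ hn.le⟩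
  have key : ∀ w : List A, wordRatio r w ≤ R ^ w.length := by
    intro w
    induction w with
    | nil => simp
    | cons i w ih =>
      rw [wordRatio_cons, List.length_cons, pow_succ']
      exact mul_le_mul (hR i).2 ih (h.wordRatio_pos w).le hR0
  simpa using key v.1

/-- A family of finer and finer parametrizations by words yields a Hölder parametrization. -/
theorem isHolderCurve_of_words (h : IsSelfSimilar φ r s K) {H C : ℝ}
    (happ : ∀ (n : ℕ) (ε : ℝ), 0 < ε → (∀ v : List.Vector A n, wordRatio r v.1 ≤ ε) →
      ∀ x : List.Vector A n → X, (∀ v, x v ∈ piece φ K v.1) →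
      ∃ E : Set (ℝ × List.Vector A n), (∀ p ∈ E, p.1 ∈ Set.Icc (0 : ℝ) 1) ∧
        (∀ t ∈ Set.Icc (0 : ℝ) 1, ∃ p ∈ E, |t - p.1| ≤ ε ^ s) ∧ (∀ v, ∃ t, (t, v) ∈ E) ∧
        ∀ p ∈ E, ∀ q ∈ E, dist (x p.2) (x q.2) ≤ H * |p.1 - q.1| ^ (1 / s) + C * ε) :
    IsHolderCurve (1 / s) K := by
  have hs := h.s_pos
  refine isHolderCurve_of_approx h.isCompact (H := H) (by positivity) fun ε hε => ?_
  obtain ⟨Δ, hΔ0, hΔ⟩ := h.exists_dist_le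
  set ε' := min (ε ^ (1 / s)) (ε / (|C| + Δ)) with hε'
  have hε'0 : 0 < ε' := lt_min (by positivity) (by positivity)
  have hε1 : ε' ^ s ≤ ε := by
    calc ε' ^ s ≤ (ε ^ (1 / s)) ^ s := Real.rpow_le_rpow hε'0.le (min_le_left _ _) hs.le
      _ = ε := by rw [← Real.rpow_mul hε.le, one_div_mul_cancel hs.ne', Real.rpow_one]
  have hε2 : (|C| + Δ) * ε' ≤ ε := by
    calc (|C| + Δ) * ε' ≤ (|C| + Δ) * (ε / (|C| + Δ)) :=
          mul_le_mul_of_nonneg_left (min_le_right _ _) (by positivity)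
      _ = ε := by field_simp
  have hC : C * ε' ≤ |C| * ε' := mul_le_mul_of_nonneg_right (le_abs_self C) hε'0.le
  have hC0 : 0 ≤ |C| * ε' := by positivity
  have hΔε : 0 < Δ * ε' := by positivity
  obtain ⟨n, hn⟩ := h.exists_forall_wordRatio_le hε'0
  choose x hx using fun v : List.Vector A n => h.piece_nonempty v.1
  have hsub : ∀ w, piece φ K w ⊆ K := fun w => by
    have := h.piece_subset_of_suffix (List.nil_suffix (l := w))
    simpa [piece, wordMap] using this
  obtain ⟨E, h1, h2, h3, h4⟩ := happ n ε' hε'0 hn x hx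
  refine ⟨(fun p => (p.1, x p.2)) '' E, ?_, ?_, ?_, ?_⟩
  · rintro _ ⟨p, hp, rfl⟩
    exact ⟨h1 p hp, hsub _ (hx _)⟩
  · intro t ht
    obtain ⟨p, hp, hpt⟩ := h2 t ht
    exact ⟨_, ⟨p, hp, rfl⟩, hpt.trans hε1⟩
  · intro a ha
    obtain ⟨v, -, hv⟩ := h.exists_mem_piece (u := []) (n := n) (by simp)
      (show a ∈ piece φ K [] by simpa [piece, wordMap] using ha)
    obtain ⟨t, ht⟩ := h3 v
    refine ⟨_, ⟨_, ht, rfl⟩, ?_⟩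
    have h5 := hΔ v.1 (x v) (hx v) a hv
    have h6 := mul_le_mul_of_nonneg_right (hn v) hΔ0.le
    simp only
    linarith
  · rintro _ ⟨p, hp, rfl⟩ _ ⟨q, hq, rfl⟩
    exact (h4 p hp q hq).trans (add_le_add le_rfl (by linarith))

/-- The choice of the number `G` of dyadic scales: `2 ^ G` grows faster than any linear function. -/
theorem exists_nat_exponent (N : ℕ) {ρ : ℝ} (hρ : 0 < ρ) :
    ∃ G : ℕ, ((N + (N + 1) * (G + 1) + 1 : ℕ) : ℝ) + 1 ≤ ρ * 2 ^ G := by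
  have h1 := tendsto_pow_const_div_const_pow_of_one_lt 1 (one_lt_two (α := ℝ))
  have h2 : (0 : ℝ) < ρ / (4 * N + 6) := by positivity
  obtain ⟨G, hG, hG1⟩ := ((h1.eventually (gt_mem_nhds h2)).and
    (Filter.eventually_ge_atTop 1)).exists
  refine ⟨G, ?_⟩
  rw [pow_one, div_lt_div_iff₀ (by positivity) (by positivity)] at hG
  have h3 : (1 : ℝ) ≤ G := by exact_mod_cast hG1
  have h4 : (0 : ℝ) ≤ N := Nat.cast_nonneg N
  push_cast
  nlinarith

/-- A self-similar set whose first-level pieces have a branching is a Hölder curve: the depth-first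
exploration of a tree on the words, in the alternating order, gives the parametrizations. -/
theorem isHolderCurve_of_hasBranching (h : IsSelfSimilar φ r s K) (hb : HasBranching φ K) :
    IsHolderCurve (1 / s) K := by
  classical
  have hs := h.s_pos
  obtain ⟨Δ, hΔ0, hΔ⟩ := h.exists_dist_le
  obtain ⟨κ, hκ0, hκ⟩ := h.exists_mass_le
  obtain ⟨ρ, _, hρ0, hρ1, -, -, hρR⟩ := h.exists_ratio_bounds
  have hρ : ∀ i, ρ ≤ r i := fun i => (hρR i).1
  -- the path has at most `N` large branches, and crosses `J` cylinders
  obtain ⟨N, hN⟩ := exists_nat_ge ((48 * Δ / ρ ^ 2) ^ s / κ)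
  obtain ⟨G, hG⟩ := exists_nat_exponent N hρ0
  obtain ⟨J, hJ⟩ : ∃ J, J = N + (N + 1) * (G + 1) + 1 := ⟨_, rfl⟩
  rw [← hJ] at hG
  have hJlt : N + (N + 1) * (G + 1) < J := by omega
  have hJ0 : (0 : ℝ) ≤ J := Nat.cast_nonneg J
  obtain ⟨c, hc⟩ : ∃ c : ℝ, c = ρ ^ 2 / (16 * (J + 1) * Δ) := ⟨_, rfl⟩
  have hc0 : 0 < c := by rw [hc]; positivity
  obtain ⟨Hc, hHc⟩ : ∃ Hc : ℝ, Hc = 1 / c := ⟨_, rfl⟩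
  have hHc0 : 0 < Hc := by rw [hHc]; positivity
  obtain ⟨C, hC⟩ : ∃ C : ℝ, C = 16 * (J + 1) * Δ / ρ := ⟨_, rfl⟩
  have hCΔ : 2 * Δ ≤ C := by
    rw [hC, le_div_iff₀ hρ0]
    nlinarith [mul_nonneg hJ0 hΔ0.le]
  refine h.isHolderCurve_of_words (H := 2 * Hc) (C := 4 * C) fun n ε hε hnε x hx => ?_
  obtain ⟨T, hT⟩ := h.exists_isWordTree hb n
  obtain ⟨rk, hrkinj, hrk⟩ := T.exists_alternating_order (T.scale r) (Int.log 2)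
  let m : List.Vector A n → ℝ := fun v => wordRatio r v.1 ^ s
  have hm : ∀ v, 0 ≤ m v := fun v => Real.rpow_nonneg (h.wordRatio_pos v.1).le s
  have hsum : ∑ v, m v = 1 := h.sum_wordRatio_rpow n
  have hCε : 2 * Δ * ε ≤ C * ε := mul_le_mul_of_nonneg_right hCΔ hε.le
  have hadj : ∀ v, dist (x v) (x (T.par v)) ≤ C * ε := by
    intro v
    obtain ⟨b, hb1, hb2⟩ := hT.adj v
    have h1 := hΔ v.1 (x v) (hx v) b hb1
    have h2 := hΔ (T.par v).1 b hb2 (x (T.par v)) (hx _)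
    have h3 := mul_le_mul_of_nonneg_right (hnε v) hΔ0.le
    have h4 := mul_le_mul_of_nonneg_right (hnε (T.par v)) hΔ0.le
    have h6 := dist_triangle (x v) b (x (T.par v))
    linarith
  have hpow : ∀ (D M : ℝ) (e : List.Vector A n), 0 < D →
      ρ ^ 2 * D / (16 * (J + 1) * Δ) < T.scale r e → T.mass m e ≤ M →
      D ≤ Hc * M ^ (1 / s) := by
    intro D M e hD he hM
    have h1 : ρ ^ 2 * D / (16 * (J + 1) * Δ) = c * D := by rw [hc]; ring
    rw [h1] at he
    have h2 := (h.rpow_le_mass (by positivity) he).trans hM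
    have h3 : c * D ≤ M ^ (1 / s) := by
      calc c * D = ((c * D) ^ s) ^ (1 / s) := by
            rw [← Real.rpow_mul (by positivity), mul_one_div_cancel hs.ne', Real.rpow_one]
        _ ≤ M ^ (1 / s) := Real.rpow_le_rpow (by positivity) h2 (by positivity)
    rw [hHc, one_div, ← div_eq_inv_mul, le_div_iff₀ hc0]
    linarith
  have hLR : ∀ z y, T.Anc z y →
      dist (x z) (x y) ≤ Hc * (T.start m rk y - T.start m rk z) ^ (1 / s) + C * ε ∧
      dist (x z) (x y) ≤ Hc *
        (T.start m rk z + T.mass m z - (T.start m rk y + T.mass m y)) ^ (1 / s) + C * ε := by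
    intro z y hzy
    have hse := hzy.start_le (rk := rk) hm
    obtain ⟨D, hD⟩ : ∃ D, D = dist (x z) (x y) := ⟨_, rfl⟩
    rw [← hD]
    have hCε0 : 0 ≤ C * ε := le_trans (by positivity) hCε
    by_cases hDC : D ≤ C * ε
    · have h1 : 0 ≤ Hc * (T.start m rk y - T.start m rk z) ^ (1 / s) :=
        mul_nonneg (by positivity) (Real.rpow_nonneg (by linarith) _)
      have h2 : 0 ≤ Hc *
          (T.start m rk z + T.mass m z - (T.start m rk y + T.mass m y)) ^ (1 / s) :=
        mul_nonneg (by positivity) (Real.rpow_nonneg (by linarith) _)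
      constructor <;> linarith
    · push Not at hDC
      have hD0 : 0 < D := by linarith
      -- the first vertex of the path at distance at least `D` from its beginning
      obtain ⟨y', hy', hmin⟩ := Finset.exists_min_image
        (Finset.univ.filter fun p => T.Anc z p ∧ T.Anc p y ∧ D ≤ dist (x z) (x p)) T.dep
        ⟨y, by simp [hzy, RTree.Anc.refl, hD]⟩
      simp only [Finset.mem_filter, Finset.mem_univ, true_and] at hy' hmin
      obtain ⟨hzy', hy'y, hDy'⟩ := hy'
      have hlt : ∀ p, T.Anc z p → T.Anc p y' → p ≠ y' → dist (x z) (x p) < D := by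
        intro p hzp hpy hne
        by_contra! hle
        have h1 := hmin p ⟨hzp, hpy.trans hy'y, hle⟩
        exact hne (hpy.eq_of_dep_eq (le_antisymm hpy.dep_le h1))
      have hball : ∀ p, T.Anc z p → T.Anc p y' → dist (x z) (x p) ≤ 2 * D := by
        intro p hzp hpy
        by_cases hne : p = y'
        · rw [hne]
          have hzne : z ≠ y' := by
            rintro rfl
            rw [dist_self] at hDy'
            linarith
          obtain ⟨hroot, hzpar⟩ := hzy'.anc_par hzne
          have h1 := hlt (T.par y') hzpar (RTree.anc_par y') (fun h1 => by
            have := T.dep_par y' hroot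
            rw [h1] at this
            omega)
          have h2 := hadj y'
          have h3 := dist_triangle_right (x z) (x y') (x (T.par y'))
          linarith
        · have := hlt p hzp hpy hne
          linarith
      obtain ⟨⟨q₁, d₁, e₁, a1, a2, a3, a4, a5, a6⟩, ⟨q₂, d₂, e₂, b1, b2, b3, b4, b5, b6⟩⟩ :=
        h.exists_branches hT hρ0 hρ hρ1 hκ0 hκ hΔ0 hΔ hN hJlt hG hx hrk hD0 (fun v => by
          have h1 : C * ρ = 16 * (J + 1) * Δ := by rw [hC]; field_simp
          rw [← h1]
          have h2 : C * wordRatio r v.1 ≤ C * ε :=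
            mul_le_mul_of_nonneg_left (hnε v) (by linarith)
          have h3 := mul_le_mul_of_nonneg_left (h2.trans hDC.le) hρ0.le
          linarith) hzy' hball hDy'
      constructor
      · refine (hpow D _ e₁ hD0 a6 ?_).trans (by linarith)
        have h1 := (a1.trans a4.anc).start_le (rk := rk) hm
        have h2 := RTree.start_add_mass_le_of_lt hm a4 a2 a5
        have h3 := (a3.trans hy'y).start_le (rk := rk) hm
        linarith
      · refine (hpow D _ e₂ hD0 b6 ?_).trans (by linarith)
        have h1 := (b1.trans b4.anc).start_le (rk := rk) hm
        have h2 := RTree.start_add_mass_le_of_lt hm b2 b4 b5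
        have h3 := (b3.trans hy'y).start_le (rk := rk) hm
        linarith
  refine ⟨{p | T.IsEvent m rk p.1 p.2}, ?_, ?_, fun v => ⟨T.start m rk v, Or.inl rfl⟩, ?_⟩
  · rintro ⟨t, v⟩ hp
    have h1 := RTree.IsEvent.mem hp hm
    have h2 := (RTree.root_anc v).start_le (T := T) (rk := rk) hm
    rw [RTree.start_root, RTree.mass_root, hsum] at h2
    exact ⟨by linarith, by linarith⟩
  · intro t ht
    obtain ⟨v, hv1, hv2⟩ := RTree.exists_start_le (T := T) (m := m) hrkinj ht.1
      (by rw [hsum]; exact ht.2)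
    refine ⟨(T.start m rk v, v), Or.inl rfl, ?_⟩
    rw [abs_of_nonneg (by simpa using hv1)]
    have h1 : m v ≤ ε ^ s := Real.rpow_le_rpow (h.wordRatio_pos v.1).le (hnε v) hs.le
    simp only
    linarith
  · rintro ⟨t, v⟩ hp ⟨t', w⟩ hq
    have := RTree.dist_le_of_isEvent (a := 1 / s) (by positivity) (by positivity)
      (le_trans (by positivity) hCε) hm hrkinj hadj (fun z y hzy => (hLR z y hzy).1)
      (fun z y hzy => (hLR z y hzy).2) hp hq
    simp only
    linarith

end IsSelfSimilar

/-! ### Self-similar sets without a branching -/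

/-- A finite connected graph without vertices of degree three has a Hamiltonian path: a path of
maximal length cannot be left from an inner vertex, and not from its ends either. -/
theorem exists_hamiltonian_list {V : Type*} [Finite V] [Nonempty V] {adj : V → V → Prop}
    (hsymm : ∀ v w, adj v w → adj w v)
    (hconn : ∀ S : Set V, S.Nonempty → S ≠ Set.univ → ∃ v ∈ S, ∃ w ∉ S, adj v w)
    (hdeg : ∀ b c₁ c₂ c₃, c₁ ≠ b → c₂ ≠ b → c₃ ≠ b → c₁ ≠ c₂ → c₁ ≠ c₃ → c₂ ≠ c₃ →
      adj b c₁ → adj b c₂ → ¬ adj b c₃) :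
    ∃ l : List V, l.Nodup ∧ (∀ v, v ∈ l) ∧ l.IsChain adj := by
  classical
  have := Fintype.ofFinite V
  obtain ⟨l, ⟨hl1, hl2⟩, hmax⟩ : ∃ l : List V, (l.Nodup ∧ l.IsChain adj) ∧
      ∀ l' : List V, l'.Nodup → l'.IsChain adj → l'.length ≤ l.length := by
    have hex : ∃ n, ∃ l : List V, (l.Nodup ∧ l.IsChain adj) ∧ l.length = n :=
      ⟨0, [], by simp, rfl⟩
    have hb : ∀ n, (∃ l : List V, (l.Nodup ∧ l.IsChain adj) ∧ l.length = n) →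
        n ≤ Fintype.card V := by
      rintro _ ⟨l, hl, rfl⟩
      exact hl.1.length_le_card
    obtain ⟨l, hl, hlen⟩ := Nat.findGreatest_spec
      (P := fun n => ∃ l : List V, (l.Nodup ∧ l.IsChain adj) ∧ l.length = n)
      (hb _ hex.choose_spec) hex.choose_spec
    refine ⟨l, hl, fun l' h1 h2 => ?_⟩
    rw [hlen]
    exact Nat.le_findGreatest (hb _ ⟨l', ⟨h1, h2⟩, rfl⟩) ⟨l', ⟨h1, h2⟩, rfl⟩
  refine ⟨l, hl1, ?_, hl2⟩
  by_contra! hne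
  obtain ⟨z, hz⟩ := hne
  have hnil : l ≠ [] := by
    rintro rfl
    have := hmax [z] (by simp) (by simp)
    simp at this
  obtain ⟨v, hv, w, hw, hadj⟩ := hconn {v | v ∈ l} (List.exists_mem_of_ne_nil l hnil)
    (fun h => hz (by rw [Set.eq_univ_iff_forall] at h; exact h z))
  obtain ⟨l₁, l₂, rfl⟩ := List.append_of_mem (show v ∈ l from hv)
  have hw' : w ∉ l₁ ++ v :: l₂ := hw
  rcases List.eq_nil_or_concat' l₁ with rfl | ⟨l₁, p, rfl⟩
  · have := hmax (w :: ([] ++ v :: l₂)) (List.nodup_cons.2 ⟨hw', hl1⟩)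
      (List.IsChain.cons_cons (hsymm _ _ hadj) hl2)
    simp at this
  rcases l₂ with _ | ⟨q, l₂⟩
  · have := hmax ((l₁ ++ [p]) ++ [v] ++ [w])
      (by
        rw [List.nodup_append]
        refine ⟨hl1, by simp, ?_⟩
        intro a ha b hb
        rw [List.mem_singleton] at hb
        rintro rfl
        exact hw' (hb ▸ ha))
      (by
        refine List.IsChain.append hl2 (by simp) ?_
        intro a ha b hb
        simp only [List.getLast?_append, List.getLast?_singleton, Option.mem_def,
          Option.some_or, Option.some.injEq, List.head?_cons] at ha hb
        subst ha; subst hb; exact hadj)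
    simp at this
  · have e1 : adj p v ∧ adj v q := by
      have := hl2
      simp only [List.append_assoc, List.singleton_append] at this
      have h2 := List.IsChain.right_of_append this
      exact ⟨(List.isChain_cons_cons.1 h2).1,
        (List.isChain_cons_cons.1 (List.isChain_cons_cons.1 h2).2).1⟩
    simp only [List.append_assoc, List.singleton_append] at hl1 hw'
    have h3 := (List.nodup_append.1 hl1).2.1
    simp only [List.nodup_cons, List.mem_cons, not_or] at h3
    simp only [List.mem_append, List.mem_cons, not_or] at hw'
    exact hdeg v p q w h3.1.1 (Ne.symm h3.2.1.1) hw'.2.2.1 h3.1.2.1 (Ne.symm hw'.2.1)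
      (Ne.symm hw'.2.2.2.1) (hsymm _ _ e1.1) e1.2 hadj

namespace IsSelfSimilar

variable {X : Type*} [MetricSpace X] {A : Type*} [Fintype A] {φ : A → X → X} {r : A → ℝ} {s : ℝ}
  {K : Set X}

/-- If no piece meets three others of the same level, then the pieces of a level form an arc or a
circle, and can be run through one after the other. On the way between two distant pieces, one
passes a piece far away from both, and, by connectedness, the whole of a piece of comparable
size. -/
theorem isHolderCurve_of_not_hasBranching (h : IsSelfSimilar φ r s K)
    (hb : ∀ n, ¬ HasBranching (fun v : List.Vector A n => wordMap φ v.1) K) :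
    IsHolderCurve (1 / s) K := by
  classical
  have hs := h.s_pos
  obtain ⟨Δ, hΔ0, hΔ⟩ := h.exists_dist_le
  obtain ⟨ρ, _, hρ0, hρ1, -, -, hρR⟩ := h.exists_ratio_bounds
  have hρ : ∀ i, ρ ≤ r i := fun i => (hρR i).1
  refine h.isHolderCurve_of_words (H := 3 * Δ / ρ) (C := 12 * Δ) fun n ε hε hnε x hx => ?_
  let adj : List.Vector A n → List.Vector A n → Prop := fun v w =>
    (piece φ K v.1 ∩ piece φ K w.1).Nonempty
  have hsymm : ∀ v w, adj v w → adj w v := fun v w hvw => by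
    simp only [adj] at hvw ⊢; rwa [Set.inter_comm]
  have hdeg : ∀ b c₁ c₂ c₃, c₁ ≠ b → c₂ ≠ b → c₃ ≠ b → c₁ ≠ c₂ → c₁ ≠ c₃ → c₂ ≠ c₃ →
      adj b c₁ → adj b c₂ → ¬ adj b c₃ := fun b c₁ c₂ c₃ h1 h2 h3 h4 h5 h6 h7 h8 h9 =>
    hb n ⟨b, c₁, c₂, c₃, h1, h2, h3, h4, h5, h6, h7, h8, h9⟩
  have hmem : ∀ v : List.Vector A n, v ∈ cyl n ([] : List A) := fun v => List.nil_suffix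
  have hne : Nonempty (List.Vector A n) := by
    obtain ⟨y, hy⟩ := h.piece_nonempty []
    obtain ⟨v, -⟩ := h.exists_mem_piece (n := n) (by simp) hy
    exact ⟨v⟩
  obtain ⟨l, hnd, hall, hch⟩ := exists_hamiltonian_list hsymm (fun S ⟨v₀, hv₀⟩ hS => by
    obtain ⟨w₀, hw₀⟩ := (Set.ne_univ_iff_exists_notMem S).1 hS
    obtain ⟨v, -, w, -, hv, hw, hvw⟩ := h.exists_inter_nonempty (by simp) (hmem v₀) hv₀
      (hmem w₀) hw₀
    exact ⟨v, hv, w, hw, hvw⟩) hdeg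
  obtain ⟨e, he⟩ : ∃ e : ℕ → List.Vector A n, ∀ k (hk : k < l.length), e k = l[k] :=
    ⟨fun k => if hk : k < l.length then l[k] else hne.some, fun k hk => by simp [hk]⟩
  have hpos : ∀ v, ∃ k < l.length, e k = v := fun v => by
    obtain ⟨k, hk, hkv⟩ := List.getElem_of_mem (hall v)
    exact ⟨k, hk, (he k hk).trans hkv⟩
  have hinj : ∀ j k, j < l.length → k < l.length → e j = e k → j = k := fun j k hj hk hjk => by
    rw [he j hj, he k hk] at hjk
    exact (hnd.getElem_inj_iff).1 hjk
  have hstep : ∀ k, k + 1 < l.length → adj (e k) (e (k + 1)) := fun k hk => by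
    rw [he k (by omega), he _ hk]
    exact List.isChain_iff_getElem.1 hch k hk
  let m : List.Vector A n → ℝ := fun v => wordRatio r v.1 ^ s
  have hm : ∀ v, 0 ≤ m v := fun v => Real.rpow_nonneg (h.wordRatio_pos v.1).le s
  let t : ℕ → ℝ := fun k => ∑ j ∈ Finset.range k, m (e j)
  have ht1 : t l.length = 1 := by
    rw [← h.sum_wordRatio_rpow n]
    refine Finset.sum_bij (fun j _ => e j) (fun _ _ => Finset.mem_univ _) ?_ ?_ fun _ _ => rfl
    · intro j hj k hk
      exact hinj j k (Finset.mem_range.1 hj) (Finset.mem_range.1 hk)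
    · intro v _
      obtain ⟨k, hk, hkv⟩ := hpos v
      exact ⟨k, Finset.mem_range.2 hk, hkv⟩
  have htmono : Monotone t := monotone_nat_of_le_succ fun k => by
    simp only [t, Finset.sum_range_succ]; linarith [hm (e k)]
  have ht0 : t 0 = 0 := by simp [t]
  have key : ∀ a b, a < b → b < l.length →
      dist (x (e a)) (x (e b)) ≤ 3 * Δ / ρ * (t b - t a) ^ (1 / s) + 12 * Δ * ε := by
    intro a b hab hbl
    have hta : 0 ≤ t b - t a := sub_nonneg.2 (htmono hab.le)
    by_cases hD : dist (x (e a)) (x (e b)) ≤ 12 * Δ * ε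
    · exact hD.trans (le_add_of_nonneg_left (by positivity))
    push Not at hD
    obtain ⟨D, hDdef⟩ : ∃ D, D = dist (x (e a)) (x (e b)) := ⟨_, rfl⟩
    rw [← hDdef] at hD ⊢
    have hΔε : 0 < Δ * ε := by positivity
    have hD0 : 0 < D := by linarith
    -- the first point of the way that is not close to its start
    have hex : ∃ k, a ≤ k ∧ D / 3 < dist (x (e a)) (x (e k)) := ⟨b, hab.le, by linarith⟩
    obtain ⟨c, ⟨hac, hDc⟩, hmin⟩ : ∃ c, (a ≤ c ∧ D / 3 < dist (x (e a)) (x (e c))) ∧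
        ∀ k < c, ¬ (a ≤ k ∧ D / 3 < dist (x (e a)) (x (e k))) :=
      ⟨Nat.find hex, Nat.find_spec hex, fun k hk => Nat.find_min hex hk⟩
    have hac' : a < c := lt_of_le_of_ne hac (by
      rintro rfl; rw [dist_self] at hDc; linarith)
    have hcb : c ≤ b := by
      by_contra! hbc
      exact hmin b hbc ⟨hab.le, by linarith⟩
    have hDcb : D / 3 < dist (x (e c)) (x (e b)) := by
      obtain ⟨k, rfl⟩ : ∃ k, c = k + 1 := ⟨c - 1, by omega⟩
      have h1 : dist (x (e a)) (x (e k)) ≤ D / 3 := by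
        have := hmin k (by omega)
        push Not at this
        exact this (by omega)
      obtain ⟨y, hy1, hy2⟩ := hstep k (by omega)
      have h2 := hΔ _ _ (hx (e k)) y hy1
      have h3 := hΔ _ y hy2 _ (hx (e (k + 1)))
      have h4 := mul_le_mul_of_nonneg_right (hnε (e k)) hΔ0.le
      have h5 := mul_le_mul_of_nonneg_right (hnε (e (k + 1))) hΔ0.le
      have h6 := dist_triangle (x (e k)) y (x (e (k + 1)))
      have h7 := dist_triangle4 (x (e a)) (x (e k)) (x (e (k + 1))) (x (e b))
      linarith
    have hcb' : c < b := lt_of_le_of_ne hcb (by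
      rintro rfl; rw [dist_self] at hDcb; linarith)
    -- a piece around that point, too small to contain one of the ends of the way
    obtain ⟨δ, hδ⟩ : ∃ δ, δ = D / (3 * Δ) := ⟨_, rfl⟩
    have hδ0 : 0 < δ := by rw [hδ]; positivity
    have hδΔ : δ * Δ = D / 3 := by rw [hδ]; field_simp
    have hcδ : wordRatio r (e c).1 ≤ δ := (hnε _).trans (by
      rw [hδ, le_div_iff₀ (by positivity)]; linarith)
    obtain ⟨u, hu⟩ : ∃ u, u = cut r δ (e c).1 := ⟨_, rfl⟩
    have hcu : e c ∈ cyl n u := by rw [hu]; exact cut_suffix r δ _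
    have huδ : wordRatio r u ≤ δ := by rw [hu]; exact wordRatio_cut_le hcδ
    have hun : u.length ≤ n := by
      have := List.IsSuffix.length_le (show u <:+ (e c).1 from hcu)
      rwa [(e c).2] at this
    have hnot : ∀ v ∈ cyl n u, dist (x v) (x (e c)) ≤ D / 3 := by
      intro v hv
      have h1 := hΔ u _ (h.piece_subset_of_suffix hv (hx v)) _
        (h.piece_subset_of_suffix hcu (hx (e c)))
      have h2 := mul_le_mul_of_nonneg_right huδ hΔ0.le
      linarith
    have hau : e a ∉ cyl n u := fun hau => by linarith [hnot _ hau]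
    have hbu : e b ∉ cyl n u := fun hbu => by
      have := hnot _ hbu; rw [dist_comm] at this; linarith
    have hu0 : u ≠ [] := by rintro rfl; exact hau (hmem _)
    have hρu : ρ * δ ≤ wordRatio r u := by
      rw [hu] at hu0 ⊢
      exact (lt_wordRatio_cut hδ0 hρ0 hρ hu0).le
    -- an inner point of the way meets only its neighbours
    have hinner : ∀ k, a < k → k < b → ∀ w, adj (e k) w → ∃ j, a ≤ j ∧ j ≤ b ∧ e j = w := by
      intro k hak hkb w hkw
      by_contra! hcon
      obtain ⟨k, rfl⟩ : ∃ k', k = k' + 1 := ⟨k - 1, by omega⟩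
      have hne' : ∀ i j, i < j → j < l.length → e i ≠ e j := fun i j hij hj hij' =>
        hij.ne (hinj i j (by omega) hj hij')
      exact hdeg (e (k + 1)) (e k) (e (k + 1 + 1)) w (hne' _ _ (by omega) (by omega))
        (hne' _ _ (by omega) (by omega)).symm (hcon (k + 1) (by omega) (by omega)).symm
        (hne' _ _ (by omega) (by omega)) (hcon k (by omega) (by omega))
        (hcon (k + 1 + 1) (by omega) (by omega)) (hsymm _ _ (hstep k (by omega)))
        (hstep (k + 1) (by omega)) hkw
    have hsub : ∀ v ∈ cyl n u, ∃ k, a < k ∧ k < b ∧ e k = v := by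
      by_contra! hcon
      obtain ⟨w₀, hw₀, hw₀'⟩ := hcon
      obtain ⟨v, hv, w, hw, ⟨k, hak, hkb, hkv⟩, hwS, hvw⟩ := h.exists_inter_nonempty hun
        (S := {v | ∃ k, a < k ∧ k < b ∧ e k = v}) hcu ⟨c, hac', hcb', rfl⟩ hw₀
        (by rintro ⟨k, h1, h2, h3⟩; exact hw₀' k h1 h2 h3)
      obtain ⟨j, haj, hjb, hjw⟩ := hinner k hak hkb w (by rw [hkv]; exact hvw)
      rcases haj.eq_or_lt with rfl | haj
      · exact hau (hjw ▸ hw)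
      rcases hjb.eq_or_lt with rfl | hjb
      · exact hbu (hjw ▸ hw)
      exact hwS ⟨j, haj, hjb, hjw⟩
    have hmass : wordRatio r u ^ s ≤ t b - t a := by
      rw [← h.sum_cyl hun]
      have h1 : t b - t a = ∑ k ∈ Finset.Ico a b, m (e k) :=
        (Finset.sum_Ico_eq_sub (fun k => m (e k)) hab.le).symm
      rw [h1, ← Finset.sum_image (f := m) (g := e) (s := Finset.Ico a b) (by
        intro i hi j hj hij
        simp only [Finset.coe_Ico, Set.mem_Ico] at hi hj
        exact hinj i j (by omega) (by omega) hij)]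
      refine Finset.sum_le_sum_of_subset_of_nonneg ?_ fun v _ _ => hm v
      intro v hv
      obtain ⟨k, h1, h2, h3⟩ := hsub v (Finset.mem_filter.1 hv).2
      exact Finset.mem_image.2 ⟨k, Finset.mem_Ico.2 ⟨h1.le, h2⟩, h3⟩
    have h1 : ρ * δ ≤ (t b - t a) ^ (1 / s) := by
      calc ρ * δ = ((ρ * δ) ^ s) ^ (1 / s) := by
            rw [← Real.rpow_mul (by positivity), mul_one_div_cancel hs.ne', Real.rpow_one]
        _ ≤ (t b - t a) ^ (1 / s) := Real.rpow_le_rpow (by positivity)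
            ((Real.rpow_le_rpow (by positivity) hρu hs.le).trans hmass) (by positivity)
    have h2 : D = 3 * Δ / ρ * (ρ * δ) := by rw [hδ]; field_simp
    have h3 := mul_le_mul_of_nonneg_left h1 (show 0 ≤ 3 * Δ / ρ by positivity)
    linarith
  refine ⟨{p | ∃ k < l.length, p = (t k, e k)}, ?_, ?_, ?_, ?_⟩
  · rintro _ ⟨k, hk, rfl⟩
    exact ⟨ht0 ▸ htmono (Nat.zero_le k), ht1 ▸ htmono hk.le⟩
  · intro y hy
    have hlen : 0 < l.length := List.length_pos_of_mem (hall hne.some)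
    obtain ⟨k, hk, hky, hky'⟩ : ∃ k < l.length, t k ≤ y ∧ y ≤ t (k + 1) := by
      have hP : (0 : ℕ) ≤ l.length - 1 ∧ t 0 ≤ y := ⟨Nat.zero_le _, by rw [ht0]; exact hy.1⟩
      have h1 := Nat.findGreatest_spec (P := fun k => t k ≤ y) hP.1 hP.2
      have h2 := Nat.findGreatest_le (P := fun k => t k ≤ y) (l.length - 1)
      refine ⟨Nat.findGreatest (fun k => t k ≤ y) (l.length - 1), by omega, h1, ?_⟩
      rcases h2.eq_or_lt with h2 | h2
      · rw [h2, Nat.sub_add_cancel hlen, ht1]; exact hy.2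
      · by_contra! h3
        have := Nat.le_findGreatest (P := fun k => t k ≤ y) (Nat.succ_le_of_lt h2) h3.le
        omega
    refine ⟨_, ⟨k, hk, rfl⟩, ?_⟩
    have h1 : t (k + 1) = t k + m (e k) := Finset.sum_range_succ _ _
    have h2 : m (e k) ≤ ε ^ s :=
      Real.rpow_le_rpow (h.wordRatio_pos _).le (hnε _) hs.le
    rw [abs_of_nonneg (by simp only; linarith)]
    simp only
    linarith
  · intro v
    obtain ⟨k, hk, rfl⟩ := hpos v
    exact ⟨t k, k, hk, rfl⟩
  · rintro _ ⟨a, ha, rfl⟩ _ ⟨b, hb', rfl⟩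
    simp only
    rcases lt_trichotomy a b with hab | rfl | hab
    · rw [abs_sub_comm, abs_of_nonneg (sub_nonneg.2 (htmono hab.le))]
      exact key a b hab hb'
    · rw [dist_self]; positivity
    · rw [dist_comm, abs_of_nonneg (sub_nonneg.2 (htmono hab.le))]
      exact key b a hab ha

end IsSelfSimilar

/-! ### Reduction to injective maps -/

namespace IsSelfSimilar

variable {X : Type*} [MetricSpace X] {A : Type*} [Fintype A] {φ : A → X → X} {r : A → ℝ} {s : ℝ}
  {K : Set X}

/-- The words of length `k` generate the same self-similar set as the letters. -/
theorem vector (h : IsSelfSimilar φ r s K) {k : ℕ} (hk : k ≠ 0) :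
    IsSelfSimilar (fun v : List.Vector A k => wordMap φ v.1) (fun v => wordRatio r v.1) s K where
  r_pos v := h.wordRatio_pos v.1
  r_lt_one := by
    rintro ⟨_ | ⟨i, w⟩, hv⟩
    · exact absurd hv.symm hk
    · have h1 := h.wordRatio_le_of_suffix (List.nil_suffix (l := w))
      rw [wordRatio_nil] at h1
      rw [wordRatio_cons]
      exact mul_lt_one_of_nonneg_of_lt_one_left (h.r_pos i).le (h.r_lt_one i) h1
  dist_map v := h.dist_wordMap v.1
  isCompact := h.isCompact
  isConnected := h.isConnected
  eq_iUnion := by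
    have hK : piece φ K [] = K := by simp [piece, wordMap]
    refine Set.Subset.antisymm (fun x hx => ?_) (Set.iUnion_subset fun v => ?_)
    · obtain ⟨v, -, hv⟩ := h.exists_mem_piece (u := []) (n := k) (by simp) (by rwa [hK])
      exact Set.mem_iUnion.2 ⟨v, hv⟩
    · have := h.piece_subset_of_suffix (List.nil_suffix (l := v.1))
      rwa [hK] at this
  s_pos := h.s_pos
  sum_rpow := h.sum_wordRatio_rpow k
  content_pos := h.content_pos

/-- A branching on any level is one on the first level for the system of the words of that length. -/
theorem isHolderCurve (h : IsSelfSimilar φ r s K) : IsHolderCurve (1 / s) K := by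
  by_cases hb : ∀ n, ¬ HasBranching (fun v : List.Vector A n => wordMap φ v.1) K
  · exact h.isHolderCurve_of_not_hasBranching hb
  · push Not at hb
    obtain ⟨k, hk⟩ := hb
    refine (h.vector ?_).isHolderCurve_of_hasBranching hk
    rintro rfl
    obtain ⟨b, c, -, -, hbc, -⟩ := hk
    exact hbc (Subsingleton.elim _ _)

end IsSelfSimilar

theorem isHolderCurve_singleton {X : Type*} [MetricSpace X] (α : ℝ) (x : X) :
    IsHolderCurve α {x} :=
  ⟨fun _ => x, continuous_const, Set.range_const, 0, fun _ _ => by simp⟩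

theorem lip_eq_ofReal {X : Type*} [MetricSpace X] [Nontrivial X] {f : X → X} {L : ℝ}
    (hf : ∀ x y, dist (f x) (f y) = L * dist x y) : lip f = ENNReal.ofReal L := by
  have key : ∀ x y : X, x ≠ y → edist (f x) (f y) / edist x y = ENNReal.ofReal L := by
    intro x y hxy
    rw [edist_dist, edist_dist, hf, ← ENNReal.ofReal_div_of_pos (dist_pos.2 hxy),
      mul_div_cancel_right₀ _ (dist_pos.2 hxy).ne']
  refine le_antisymm (iSup_le fun x => iSup_le fun y => iSup_le fun hxy => (key x y hxy).le) ?_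
  obtain ⟨x, y, hxy⟩ := exists_pair_ne X
  rw [← key x y hxy]
  exact le_iSup_of_le x (le_iSup_of_le y (le_iSup_of_le hxy le_rfl))

/-- A connected attractor with two points is already generated by the injective maps: the constant
maps only contribute finitely many points, which would be isolated. -/
theorem IsAttractor.eq_iUnion_of_nontrivial {X : Type*} [MetricSpace X] {ι : Type*} [Fintype ι]
    {F : ι → X → X} {K : Set X} (hK : IsAttractor F K) (hconn : IsConnected K)
    (hnt : K.Nontrivial) {L : ι → ℝ} (hL0 : ∀ i, 0 ≤ L i)
    (hL : ∀ i x y, dist (F i x) (F i y) = L i * dist x y) :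
    K = ⋃ i : {i // 0 < L i}, F i '' K := by
  set C := ⋃ i : {i // 0 < L i}, F i '' K with hC
  have hCK : C ⊆ K := by
    rw [hC]
    refine Set.iUnion_subset fun i => ?_
    conv_rhs => rw [hK.eq_iUnion]
    exact Set.subset_iUnion (fun i => F i '' K) i.1
  have hcont : ∀ i, Continuous (F i) := fun i =>
    (LipschitzWith.of_dist_le_mul (K := Real.toNNReal (L i)) fun x y => by
      rw [hL, Real.coe_toNNReal _ (hL0 i)]).continuous
  have hCcl : IsClosed C := isClosed_iUnion_of_finite fun i =>
    (hK.isCompact.image (hcont i)).isClosed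
  have hfin : (K \ C).Finite := by
    obtain ⟨z, hz⟩ := hK.nonempty
    refine (Set.finite_range fun i => F i z).subset ?_
    rintro x ⟨hx, hxC⟩
    rw [hK.eq_iUnion, Set.mem_iUnion] at hx
    obtain ⟨i, y, hy, rfl⟩ := hx
    refine ⟨i, ?_⟩
    have hLi : L i = 0 := by
      by_contra hLi
      exact hxC (Set.mem_iUnion.2 ⟨⟨i, lt_of_le_of_ne (hL0 i) (Ne.symm hLi)⟩, y, hy, rfl⟩)
    rw [← dist_eq_zero]
    simp only [hL, hLi, zero_mul]
  refine Set.Subset.antisymm (fun x hx => ?_) hCK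
  by_contra hxC
  obtain ⟨y, hyK, hyC⟩ : (K ∩ C).Nonempty := by
    by_contra hne
    rw [Set.not_nonempty_iff_eq_empty, ← Set.disjoint_iff_inter_eq_empty] at hne
    rw [hne.sdiff_eq_left] at hfin
    exact hconn.isPreconnected.infinite_of_nontrivial hnt hfin
  obtain ⟨z, -, hz1, hz2⟩ := isPreconnected_closed_iff.1 hconn.isPreconnected C (K \ C) hCcl
    hfin.isClosed (fun x hx => by
      by_cases h : x ∈ C
      · exact Or.inl h
      · exact Or.inr ⟨hx, h⟩) ⟨y, hyK, hyC⟩ ⟨x, hx, hx, hxC⟩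
  exact hz2.2 hz1

/-- A contracting similarity decreases the diameter, so it maps no compact set of two or more points
onto itself. -/
theorem IsCompact.subsingleton_of_image_eq {X : Type*} [MetricSpace X] {K : Set X}
    (hK : IsCompact K) {f : X → X} {L : ℝ} (hL1 : L < 1)
    (hf : ∀ x y, dist (f x) (f y) = L * dist x y) (hfK : f '' K = K) : K.Subsingleton := by
  intro x hx y hy
  obtain ⟨⟨a, b⟩, ⟨ha, hb⟩, hmax⟩ := (hK.prod hK).exists_isMaxOn ⟨(x, y), hx, hy⟩
    (continuous_dist.continuousOn (s := K ×ˢ K))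
  have hmax' : ∀ p ∈ K, ∀ q ∈ K, dist p q ≤ dist a b := fun p hp q hq =>
    isMaxOn_iff.1 hmax (p, q) ⟨hp, hq⟩
  simp only at ha hb
  rw [← hfK] at ha hb
  obtain ⟨a', ha', haa⟩ := ha
  obtain ⟨b', hb', hbb⟩ := hb
  have h1 := hmax' a' ha' b' hb'
  have h2 := hf a' b'
  rw [haa, hbb] at h2
  have h3 : dist a' b' ≤ 0 := by
    by_contra! h
    nlinarith
  have h4 : dist a' b' = 0 := le_antisymm h3 dist_nonneg
  rw [h4, mul_zero] at h2
  exact dist_le_zero.1 (h2 ▸ hmax' x hx y hy)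

/-- A connected attractor of positive `s`-dimensional Hausdorff measure of an iterated function
system of similarities with similarity dimension `s` is a `(1/s)`-Hölder curve. In the degenerate
case `s = 0` (where `1/s = ∞`) it is an `α`-Hölder curve for every `α > 0`. -/
theorem theorem1p3 {X : Type*} [MetricSpace X] [CompleteSpace X]
    [MeasurableSpace X] [BorelSpace X] {ι : Type*} [Fintype ι]
    (F : ι → X → X) (hF : IsIFS F) (hsim : ∀ i, IsSimilarity (F i))
    (s : ℝ) (hs : IsSimilarityDimension F s)
    (K : Set X) (hK : IsAttractor F K) (hconn : IsConnected K) (hpos : 0 < μH[s] K) :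
    (0 < s → IsHolderCurve (1 / s) K) ∧ (s = 0 → ∀ α : ℝ, 0 < α → IsHolderCurve α K) := by
  classical
  rcases K.subsingleton_or_nontrivial with hsub | hnt
  · obtain ⟨x, hx⟩ := hK.nonempty
    rw [hsub.eq_singleton_of_mem hx]
    exact ⟨fun _ => isHolderCurve_singleton _ _, fun _ _ _ => isHolderCurve_singleton _ _⟩
  have hX : Nontrivial X := by
    obtain ⟨x, -, y, -, hxy⟩ := hnt
    exact ⟨x, y, hxy⟩
  choose L hL0 hL1 hL using hsim
  have hlip : ∀ i, lip (F i) = ENNReal.ofReal (L i) := fun i => lip_eq_ofReal (hL i)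
  have hcover := hK.eq_iUnion_of_nontrivial hconn hnt hL0 hL
  have hsum : ∑ i : {i // 0 < L i}, L i ^ s = 1 := by
    rcases hs with ⟨htriv, -⟩ | ⟨-, hs⟩
    · obtain ⟨x, hx⟩ := hK.nonempty
      rw [hcover, Set.mem_iUnion] at hx
      obtain ⟨⟨i, hi⟩, -⟩ := hx
      have := htriv i
      rw [hlip, ENNReal.ofReal_eq_zero] at this
      exact absurd this hi.not_ge
    · rw [← hs, ← Finset.sum_subtype (Finset.univ.filter fun i => 0 < L i) (by simp)
        (fun i => L i ^ s), Finset.sum_filter]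
      refine Finset.sum_congr rfl fun i _ => ?_
      rw [hlip, ENNReal.toReal_ofReal (hL0 i)]
      simp only [ENNReal.ofReal_eq_zero]
      rcases (hL0 i).eq_or_lt with h | h
      · simp [← h]
      · simp [h, h.not_ge]
  refine ⟨fun hs0 => ?_, ?_⟩
  · have h : IsSelfSimilar (fun i : {i // 0 < L i} => F i) (fun i => L i) s K :=
      { r_pos := fun i => i.2
        r_lt_one := fun i => hL1 i
        dist_map := fun i => hL i
        isCompact := hK.isCompact
        isConnected := hconn
        eq_iUnion := hcover
        s_pos := hs0
        sum_rpow := hsum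
        content_pos := hausdorffContent_pos hs0 hpos }
    exact h.isHolderCurve
  -- for `s = 0` the system has a single injective map, and this maps `K` onto itself
  · rintro rfl
    simp only [Real.rpow_zero, Finset.sum_const, Finset.card_univ, nsmul_eq_mul, mul_one,
      Nat.cast_eq_one] at hsum
    obtain ⟨i, hi⟩ := Fintype.card_eq_one_iff.1 hsum
    have hKi : F i '' K = K := by
      conv_rhs => rw [hcover]
      refine Set.Subset.antisymm (Set.subset_iUnion (fun i : {i // 0 < L i} => F i '' K) i)
        (Set.iUnion_subset fun j => by rw [hi j])
    exact absurd (hK.isCompact.subsingleton_of_image_eq (hL1 i) (hL i) hKi)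
      (Set.not_subsingleton_iff.2 hnt)
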